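/- Let $d>2$ be an integer, let $T$ be the $d$-regular tree with vertex set $VT$ and set of oriented edges $ET$, and let $[d]=\{1,\dots,d\}$. For $v\in VT$ let $E(v)$ be the set of oriented edges with origin $v$. A coloring is a map $c\colon ET\to[d]$ whose restriction $c_v\colon E(v)\to[d]$ is a bijection for every $v\in VT$; it is legal if $c(e)=c(\overline e)$ for every edge $e$, where $\overline e$ is the reverse of $e$. For $g\in\mathrm{Aut}(T)$ and $v\in VT$ the local action of $g$ at $v$ is $\sigma_c(g,v)=c_{g(v)}\circ g\circ c_v^{-1}\in\mathrm{Sym}(d)$. For $F\le F'\le\mathrm{Sym}(d)$ the restricted Burger--Mozes group is \[ G_c(F,F')=\{g\in\mathrm{Aut}(T) : \sigma_c(g,v)\in F' \text{ for all } v\in VT, \text{ and } \sigma_c(g,v)\in F \text{ for all but finitely many } v\in VT\}. \] Let $\widehat F\le\mathrm{Sym}(d)$ be the Young group of the orbit partition of $F$, i.e. the group of all permutations that preserve each $F$-orbit on $[d]$ setwise. \textbf{Proposition.} Let $d>2$ be an integer, let $c$ be a legal coloring of the $d$-regular tree $T$, and let $F\le F'\le\widehat F$ be subgroups of $\mathrm{Sym}(d)$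 such that the action of $F'$ on $[d]$ is not free (some non-identity element of $F'$ fixes a point). Then $G_c(F,F')$ is virtually simple, i.e. has a subgroup of finite index that is simple as an abstract group, if and only if $F'$ is transitive on $[d]$ and is generated by its point stabilizers. -/

import Mathlib

namespace BurgerMozes

/-- The set `E(v)` of oriented edges with origin `v`. -/
abbrev Star {V : Type*} (T : SimpleGraph V) (v : V) : Type _ :=
  {e : T.Dart // e.fst = v}

/-- A coloring of a graph: a map `c` from the oriented edges to `X` whose restriction to `E(v)` is a
bijection onto `X`, for every vertex `v`. -/
structure Coloring {V : Type*} (T : SimpleGraph V) (X : Type*) where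
  /-- The color of an oriented edge. -/
  color : T.Dart → X
  /-- Every color occurs exactly once at each vertex. -/
  bijective : ∀ v : V, Function.Bijective fun e : Star T v => color e.1

/-- A coloring is legal if each oriented edge has the same color as its reverse. -/
def Coloring.IsLegal {V : Type*} {T : SimpleGraph V} {X : Type*} (c : Coloring T X) : Prop :=
  ∀ e : T.Dart, c.color e = c.color e.symm

/-- The bijection `c_v : E(v) → X`. -/
noncomputable def Coloring.atVertex {V : Type*} {T : SimpleGraph V} {X : Type*}
    (c : Coloring T X) (v : V) : Star T v ≃ X :=
  Equiv.ofBijective _ (c.bijective v)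

/-- The bijection `E(v) → E(g(v))` induced by an automorphism `g`. -/
def starMap {V : Type*} {T : SimpleGraph V} (g : T ≃g T) (v : V) : Star T v ≃ Star T (g v) where
  toFun e := ⟨⟨(g e.1.fst, g e.1.snd), g.map_rel_iff.2 e.1.adj⟩, congrArg g e.2⟩
  invFun e := ⟨⟨(g.symm e.1.fst, g.symm e.1.snd), g.symm.map_rel_iff.2 e.1.adj⟩,
    (congrArg g.symm e.2).trans (g.symm_apply_apply v)⟩
  left_inv e := by
    apply Subtype.ext
    apply SimpleGraph.Dart.ext
    simp
  right_inv e := by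
    apply Subtype.ext
    apply SimpleGraph.Dart.ext
    simp

/-- The local action `σ_c(g, v) = c_{g(v)} ∘ g ∘ c_v⁻¹` of `g` at `v`. -/
noncomputable def localAction {V : Type*} {T : SimpleGraph V} {X : Type*}
    (c : Coloring T X) (g : T ≃g T) (v : V) : Equiv.Perm X :=
  (c.atVertex v).symm.trans ((starMap g v).trans (c.atVertex (g v)))

theorem localAction_one {V : Type*} {T : SimpleGraph V} {X : Type*}
    (c : Coloring T X) (v : V) : localAction c 1 v = 1 := by
  ext x
  exact (c.atVertex v).apply_symm_apply x

theorem localAction_mul {V : Type*} {T : SimpleGraph V} {X : Type*}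
    (c : Coloring T X) (g h : T ≃g T) (v : V) :
    localAction c (g * h) v = localAction c g (h v) * localAction c h v := by
  ext x
  have : (c.atVertex (h v)).symm (localAction c h v x) =
      starMap h v ((c.atVertex v).symm x) := by
    simp [localAction]
  change _ = c.atVertex (g (h v)) (starMap g (h v)
    ((c.atVertex (h v)).symm (localAction c h v x)))
  rw [this]
  rfl

theorem localAction_inv {V : Type*} {T : SimpleGraph V} {X : Type*}
    (c : Coloring T X) (g : T ≃g T) (v : V) :
    localAction c g⁻¹ v = (localAction c g (g⁻¹ v))⁻¹ := by
  rw [eq_inv_iff_mul_eq_one, ← localAction_one c (g⁻¹ v)]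
  have h := localAction_mul c g⁻¹ g (g⁻¹ v)
  rw [inv_mul_cancel] at h
  rw [h]
  have : g (g⁻¹ v) = v := g.apply_symm_apply v
  rw [this]

/-- The restricted Burger--Mozes group `G_c(F, F')`: all automorphisms whose local action is in `F'`
at every vertex and in `F` at all but finitely many vertices. -/
def restrictedBurgerMozes {V : Type*} {T : SimpleGraph V} {X : Type*}
    (c : Coloring T X) (F F' : Subgroup (Equiv.Perm X)) : Subgroup (T ≃g T) where
  carrier := {g | (∀ v : V, localAction c g v ∈ F') ∧ {v : V | localAction c g v ∉ F}.Finite}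
  one_mem' := by simp [localAction_one, one_mem]
  mul_mem' := by
    rintro g h ⟨hg, hg'⟩ ⟨hh, hh'⟩
    refine ⟨fun v => ?_, ?_⟩
    · rw [localAction_mul]
      exact mul_mem (hg _) (hh _)
    · refine ((hg'.preimage (h.injective.injOn)).union hh').subset fun v hv => ?_
      by_contra hn
      simp only [Set.mem_union, Set.mem_preimage, Set.mem_ofPred_eq, not_or, not_not] at hn
      apply hv
      rw [localAction_mul]
      exact mul_mem hn.1 hn.2
  inv_mem' := by
    rintro g ⟨hg, hg'⟩
    refine ⟨fun v => ?_, ?_⟩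
    · rw [localAction_inv]
      exact inv_mem (hg _)
    · refine (hg'.preimage ((g⁻¹).injective.injOn)).subset fun v hv => ?_
      intro hn
      apply hv
      rw [localAction_inv]
      exact inv_mem hn

/-- The Young group of a partition (given as an equivalence relation): all permutations that fix each
part setwise. -/
def youngGroup {X : Type*} (r : Setoid X) : Subgroup (Equiv.Perm X) where
  carrier := {s | ∀ P ∈ r.classes, s '' P = P}
  one_mem' := by simp
  mul_mem' := by
    intro s t hs ht P hP
    rw [Equiv.Perm.coe_mul, Set.image_comp, ht P hP, hs P hP]
  inv_mem' := by
    intro s hs P hP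
    nth_rewrite 1 [← hs P hP]
    rw [← Set.image_comp, ← Equiv.Perm.coe_mul]
    simp

/-- The Young group associated to the partition of `X` into the orbits of `D`. -/
def orbitYoungGroup {X : Type*} (D : Subgroup (Equiv.Perm X)) : Subgroup (Equiv.Perm X) :=
  youngGroup (MulAction.orbitRel D X)

/-- A permutation group acts freely if all its point stabilizers are trivial. -/
def ActsFreely {X : Type*} (D : Subgroup (Equiv.Perm X)) : Prop :=
  ∀ x : X, MulAction.stabilizer D x = ⊥

/-- A permutation group is generated by its point stabilizers. -/
def GeneratedByPointStabilizers {X : Type*} (D : Subgroup (Equiv.Perm X)) : Prop :=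
  ⨆ x : X, MulAction.stabilizer D x = ⊤

/-- A group is virtually simple if it has a simple subgroup of finite index. -/
def VirtuallySimple (G : Type*) [Group G] : Prop :=
  ∃ H : Subgroup G, H.FiniteIndex ∧ IsSimpleGroup H

end BurgerMozes

/-!
The group `G = G(F, F')` is studied through the rigid stabilizers `rist v a` of half-trees, that
is, the subgroups of elements supported in the half-tree beyond the edge of color `a` at `v`. Two
facts make them effective. An automorphism may be prescribed by its local actions, as long as
these agree along every edge on the color of that edge (`exists_automorphism`). And `G` has edge
independence: an element that fixes an edge can be restricted to either of its two half-trees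
(`exists_restrict`).

*Necessity.* Let `ristGroup` be generated by all rigid stabilizers. It is normal in `G`, and
infinite because `F'` is not free, so it has finite index when `G` is virtually simple. Its
elements have local actions in the subgroup `E` of `F'` generated by the point stabilizers. If `E`
were intransitive, a splitting of the colors into two `E`-invariant parts would give a map from
the tree onto a line, the Cayley graph of the infinite dihedral group, in which an edge of the
tree acts through the part of its color. Elements of `ristGroup` preserve this map, while the
color-preserving automorphisms, which are transitive on vertices, take infinitely many values
under it, contradicting finite index (`exists_apply_eq_of_finiteIndex`). So `E` is transitive, and
since it contains point stabilizers it is all of `F'`.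

*Sufficiency.* Let `ristCommutator` be generated by the commutator subgroups of the rigid
stabilizers. Its vertex stabilizers realize all of `F'` as local actions
(`Setting.exists_ristCommutator_localAction`), so it can move any half-tree into any other.

* It is simple (`Setting.isSimpleGroup`): a nontrivial normal subgroup contains an element that
  moves some half-tree off itself, and a double commutator then gives the commutators of the rigid
  stabilizers.
* It has finite index (`Setting.finiteIndex`). Half-trees can be moved off each other, so
  `ristGroup` is abelian modulo `ristCommutator`. An element of a rigid stabilizer all of whose
  local actions lie in `F` is the commutator of an infinite product of its translates with a
  color-preserving translation, hence lies in `ristCommutator`. Consequently the elements with a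
  single exceptional vertex have finite image in the quotient, and together with one
  color-preserving automorphism they generate `G` in a bounded way.
-/

namespace BurgerMozes

open scoped commutatorElement

section Tree

/-! ### Neighbours and local actions -/

variable {V X : Type*} {T : SimpleGraph V} {c : Coloring T X}

/-- The end of the edge of color `a` with origin `v`. -/
noncomputable def Coloring.nb (c : Coloring T X) (v : V) (a : X) : V :=
  ((c.atVertex v).symm a).1.snd

theorem adj_nb (c : Coloring T X) (v : V) (a : X) : T.Adj v (c.nb v a) := by
  have h := ((c.atVertex v).symm a).1.adj
  rwa [((c.atVertex v).symm a).2] at h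

theorem nb_atVertex (c : Coloring T X) {v : V} (e : Star T v) :
    c.nb v (c.atVertex v e) = e.1.snd := by
  simp [Coloring.nb]

theorem nb_color (c : Coloring T X) {v w : V} (h : T.Adj v w) :
    c.nb v (c.color ⟨(v, w), h⟩) = w :=
  nb_atVertex c (⟨⟨(v, w), h⟩, rfl⟩ : Star T v)

theorem exists_nb_eq (c : Coloring T X) {v w : V} (h : T.Adj v w) : ∃ a, c.nb v a = w :=
  ⟨_, nb_color c h⟩

theorem nb_injective (c : Coloring T X) (v : V) : Function.Injective (c.nb v) := by
  intro a b h
  apply (c.atVertex v).symm.injective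
  apply Subtype.ext
  apply SimpleGraph.Dart.ext
  refine Prod.ext ?_ h
  exact ((c.atVertex v).symm a).2.trans ((c.atVertex v).symm b).2.symm

theorem color_nb (c : Coloring T X) (v : V) (a : X) :
    c.color ⟨(v, c.nb v a), adj_nb c v a⟩ = a :=
  nb_injective c v (nb_color c (adj_nb c v a))

theorem Coloring.IsLegal.nb_nb (hc : c.IsLegal) (v : V) (a : X) : c.nb (c.nb v a) a = v := by
  have h := hc ⟨(v, c.nb v a), adj_nb c v a⟩
  rw [color_nb] at h
  have h' := nb_color c (adj_nb c v a).symm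
  exact (congrArg (c.nb (c.nb v a)) h).trans h'

theorem apply_nb (c : Coloring T X) (g : T ≃g T) (v : V) (a : X) :
    g (c.nb v a) = c.nb (g v) (localAction c g v a) := by
  simp [localAction, starMap, Coloring.nb]

theorem localAction_eq {g : T ≃g T} {v : V} {s : Equiv.Perm X}
    (h : ∀ a, g (c.nb v a) = c.nb (g v) (s a)) : localAction c g v = s := by
  ext a
  exact nb_injective c (g v) ((apply_nb c g v a).symm.trans (h a))

theorem localAction_congr {g h : T ≃g T} {v : V} (hv : g v = h v)
    (hn : ∀ a, g (c.nb v a) = h (c.nb v a)) : localAction c g v = localAction c h v :=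
  localAction_eq fun a => by rw [hn, hv, apply_nb]

/-- A property that holds at one vertex and passes to neighbours holds everywhere. -/
theorem nb_induction (c : Coloring T X) (hT : T.IsTree) {p : V → Prop} {v₀ : V} (h₀ : p v₀)
    (hs : ∀ v a, p v → p (c.nb v a)) (v : V) : p v := by
  obtain ⟨w⟩ := hT.connected.preconnected v₀ v
  induction w with
  | nil => exact h₀
  | cons h w ih =>
    obtain ⟨a, rfl⟩ := exists_nb_eq c h
    exact ih (hs _ _ h₀)

/-! ### Half-trees -/

/-- The half-tree beyond the edge of color `a` at `v`: the component of `nb v a` after that edge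
has been removed. -/
def Coloring.half (c : Coloring T X) (v : V) (a : X) : Set V :=
  {u | (T.deleteEdges {s(v, c.nb v a)}).Reachable (c.nb v a) u}

theorem nb_mem_half (c : Coloring T X) (v : V) (a : X) : c.nb v a ∈ c.half v a :=
  SimpleGraph.Reachable.refl _

theorem notMem_half (c : Coloring T X) (hT : T.IsTree) (v : V) (a : X) : v ∉ c.half v a := by
  intro h
  have := SimpleGraph.isAcyclic_iff_forall_adj_isBridge.1 hT.isAcyclic (adj_nb c v a)
  exact SimpleGraph.isBridge_iff.1 this h.symm

/-- The only edge that leaves a half-tree is the one that defines it. -/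
theorem eq_of_leaves_half (hT : T.IsTree) (hc : c.IsLegal) {v u : V} {a b : X}
    (hu : u ∈ c.half v a) (hn : c.nb u b ∉ c.half v a) : u = c.nb v a ∧ c.nb u b = v ∧ b = a := by
  by_cases he : s(u, c.nb u b) = s(v, c.nb v a)
  · rcases Sym2.eq_iff.1 he with ⟨h, -⟩ | ⟨h, h'⟩
    · exact absurd hu (h ▸ notMem_half c hT v a)
    · refine ⟨h, h', ?_⟩
      subst h
      exact nb_injective c _ (h'.trans (hc.nb_nb v a).symm)
  · refine absurd (SimpleGraph.Reachable.trans hu (SimpleGraph.Adj.reachable ?_)) hn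
    rw [SimpleGraph.deleteEdges_adj]
    exact ⟨adj_nb c u b, he⟩

/-- A set of vertices that no edge leaves is empty or everything. -/
theorem forall_notMem_of_closed (c : Coloring T X) (hT : T.IsTree) (hc : c.IsLegal) {S : Set V}
    {v₀ : V} (h₀ : v₀ ∉ S) (hS : ∀ v a, v ∈ S → c.nb v a ∈ S) (v : V) : v ∉ S :=
  nb_induction c hT (p := fun v => v ∉ S) h₀
    (fun v a hv h => hv (hc.nb_nb v a ▸ hS _ a h)) v

/-- Two half-trees neither of which contains the origin of the other are disjoint. -/
theorem half_disjoint (hT : T.IsTree) (hc : c.IsLegal) {v w : V} {a b : X}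
    (hne : v ≠ w) (hw : w ∉ c.half v a) (hv : v ∉ c.half w b) :
    Disjoint (c.half v a) (c.half w b) := by
  rw [Set.disjoint_left]
  intro u hu hu'
  refine forall_notMem_of_closed c hT hc (S := c.half v a ∩ c.half w b) (v₀ := v)
    (fun h => hv h.2) ?_ u ⟨hu, hu'⟩
  rintro x e ⟨hx, hx'⟩
  by_contra hn
  rw [Set.mem_inter_iff, not_and_or] at hn
  rcases hn with hn | hn
  · obtain ⟨-, h2, -⟩ := eq_of_leaves_half hT hc hx hn
    obtain ⟨-, h2', -⟩ := eq_of_leaves_half hT hc hx' (h2 ▸ hv)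
    exact hne (h2.symm.trans h2')
  · obtain ⟨-, h2, -⟩ := eq_of_leaves_half hT hc hx' hn
    obtain ⟨-, h2', -⟩ := eq_of_leaves_half hT hc hx (h2 ▸ hw)
    exact hne (h2'.symm.trans h2)

theorem half_disjoint_of_ne (hT : T.IsTree) (hc : c.IsLegal) (v : V) {a b : X}
    (hne : a ≠ b) : Disjoint (c.half v a) (c.half v b) := by
  rw [Set.disjoint_left]
  intro u hu hu'
  refine forall_notMem_of_closed c hT hc (S := c.half v a ∩ c.half v b) (v₀ := v)
    (fun h => notMem_half c hT v a h.1) ?_ u ⟨hu, hu'⟩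
  rintro x e ⟨hx, hx'⟩
  by_contra hn
  rw [Set.mem_inter_iff, not_and_or] at hn
  have key : x = c.nb v a ∧ x = c.nb v b := by
    rcases hn with hn | hn
    · obtain ⟨h1, h2, -⟩ := eq_of_leaves_half hT hc hx hn
      exact ⟨h1, (eq_of_leaves_half hT hc hx' (by rw [h2]; exact notMem_half c hT v b)).1⟩
    · obtain ⟨h1, h2, -⟩ := eq_of_leaves_half hT hc hx' hn
      exact ⟨(eq_of_leaves_half hT hc hx (by rw [h2]; exact notMem_half c hT v a)).1, h1⟩
  exact hne (nb_injective c v (key.1.symm.trans key.2))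

/-- The half-trees on the two sides of an edge are complementary. -/
theorem mem_half_nb_iff (hT : T.IsTree) (hc : c.IsLegal) {v u : V} {a : X} :
    u ∈ c.half (c.nb v a) a ↔ u ∉ c.half v a := by
  refine nb_induction c hT (p := fun u => u ∈ c.half (c.nb v a) a ↔ u ∉ c.half v a) (v₀ := v)
    ?_ ?_ u
  · have := nb_mem_half c (c.nb v a) a
    rw [hc.nb_nb] at this
    exact iff_of_true this (notMem_half c hT v a)
  · intro x b hx
    by_cases hxv : x ∈ c.half v a
    · have hx' : x ∉ c.half (c.nb v a) a := fun h => hx.1 h hxv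
      by_cases hn : c.nb x b ∈ c.half v a
      · refine iff_of_false (fun h => ?_) (not_not.2 hn)
        have h3 := eq_of_leaves_half hT hc (b := b) h (by rwa [hc.nb_nb])
        rw [h3.1, hc.nb_nb] at hn
        exact notMem_half c hT v a hn
      · obtain ⟨-, h2, -⟩ := eq_of_leaves_half hT hc hxv hn
        rw [h2]
        have := nb_mem_half c (c.nb v a) a
        rw [hc.nb_nb] at this
        exact iff_of_true this (notMem_half c hT v a)
    · have hx' := hx.2 hxv
      by_cases hn : c.nb x b ∈ c.half v a
      · have h3 := eq_of_leaves_half hT hc (b := b) hn (by rwa [hc.nb_nb])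
        rw [h3.1]
        exact iff_of_false (notMem_half c hT _ a) (not_not.2 (nb_mem_half c v a))
      · refine iff_of_true ?_ hn
        by_contra hn'
        obtain ⟨-, h2, -⟩ := eq_of_leaves_half hT hc hx' hn'
        exact hn (h2 ▸ nb_mem_half c v a)

/-- A half-tree starting at the end of an edge and not turning back lies beyond that edge. -/
theorem half_nb_subset (hT : T.IsTree) (hc : c.IsLegal) (v : V) {a b : X} (hne : b ≠ a) :
    c.half (c.nb v a) b ⊆ c.half v a := by
  intro u hu
  by_contra h
  exact Set.disjoint_left.1 (half_disjoint_of_ne hT hc (c.nb v a) hne) hu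
    ((mem_half_nb_iff hT hc).2 h)

theorem exists_mem_half (hT : T.IsTree) (hc : c.IsLegal) {v u : V} (hne : u ≠ v) :
    ∃ a, u ∈ c.half v a := by
  refine (nb_induction c hT (p := fun u => u = v ∨ ∃ a, u ∈ c.half v a) (v₀ := v)
    (Or.inl rfl) ?_ u).resolve_left hne
  rintro x b (rfl | ⟨a, ha⟩)
  · exact Or.inr ⟨b, nb_mem_half c _ b⟩
  · by_cases hn : c.nb x b ∈ c.half v a
    · exact Or.inr ⟨a, hn⟩
    · exact Or.inl (eq_of_leaves_half hT hc ha hn).2.1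

theorem apply_mem_half_iff (hT : T.IsTree) (hc : c.IsLegal) (g : T ≃g T) {v u : V} {a : X} :
    g u ∈ c.half (g v) (localAction c g v a) ↔ u ∈ c.half v a := by
  refine nb_induction c hT
    (p := fun u => g u ∈ c.half (g v) (localAction c g v a) ↔ u ∈ c.half v a) (v₀ := v)
    (iff_of_false (notMem_half c hT _ _) (notMem_half c hT _ _)) ?_ u
  intro x b hx
  -- both sides change exactly when the edge from `x` is the defining edge
  by_cases hxv : x ∈ c.half v a
  · have hgx := hx.2 hxv
    constructor
    · intro h
      by_contra hn
      obtain ⟨-, h2, -⟩ := eq_of_leaves_half hT hc hxv hn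
      rw [h2] at h
      exact notMem_half c hT _ _ h
    · intro h
      by_contra hn
      rw [apply_nb] at hn
      obtain ⟨-, h2, -⟩ := eq_of_leaves_half hT hc hgx hn
      rw [← apply_nb] at h2
      rw [g.injective h2] at h
      exact notMem_half c hT _ _ h
  · have hgx := fun h => hxv (hx.1 h)
    constructor
    · intro h
      rw [apply_nb] at h
      obtain ⟨h1, -, -⟩ := eq_of_leaves_half hT hc (b := localAction c g x b) h
        (by rwa [hc.nb_nb])
      rw [← apply_nb, ← apply_nb] at h1
      rw [g.injective h1]
      exact nb_mem_half c v a
    · intro h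
      obtain ⟨h1, -, -⟩ := eq_of_leaves_half hT hc (b := b) h (by rwa [hc.nb_nb])
      rw [h1, apply_nb]
      exact nb_mem_half c _ _

/-! ### Recursion from a root -/

/-- The value at the start of a walk obtained by iterating `Φ` from its end. -/
noncomputable def walkValue (c : Coloring T X) {Y : Type*} (y₀ : Y) (Φ : V → X → Y → Y) :
    ∀ {u v : V}, T.Walk u v → Y
  | _, _, .nil => y₀
  | _, _, .cons (u := u) (v := v) h p => Φ v (c.color ⟨(v, u), h.symm⟩) (walkValue c y₀ Φ p)

/-- Recursion on a tree rooted at `v₀`. `R v a` says that `nb v a` is a child of `v`: of the two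
ends of an edge one is a child of the other, and only the root is not a child. -/
theorem exists_rec (hT : T.IsTree) (hc : c.IsLegal) (v₀ : V) {Y : Type*} (y₀ : Y)
    (Φ : V → X → Y → Y) :
    ∃ (R : V → X → Prop) (f : V → Y), f v₀ = y₀ ∧ (∀ v a, R v a ∨ R (c.nb v a) a) ∧
      (∀ v a, R v a → f (c.nb v a) = Φ v a (f v)) ∧ ∀ w, w ≠ v₀ → ∃ v a, R v a ∧ c.nb v a = w := by
  classical
  choose path hpath huniq using fun v => hT.existsUnique_path v v₀
  have dich : ∀ v w (h : T.Adj v w), path v = .cons h (path w) ∨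
      path w = .cons h.symm (path v) := by
    intro v w h
    by_cases hw : w ∈ (path v).support
    · left
      symm
      apply huniq
      refine (SimpleGraph.Walk.cons_isPath_iff h (path w)).2 ⟨hpath w, fun hv => ?_⟩
      have h1 : path v = (SimpleGraph.Walk.cons h .nil).append ((path v).dropUntil w hw) := by
        conv_lhs => rw [← SimpleGraph.Walk.take_spec (path v) hw]
        congr 1
        have := (hT.isAcyclic.subsingleton_path v w).elim ⟨_, (hpath v).takeUntil hw⟩
          (SimpleGraph.Path.singleton h)
        exact congrArg Subtype.val this
      have h2 : (path v).dropUntil w hw = path w := huniq _ _ ((hpath v).dropUntil hw)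
      rw [h2] at h1
      have h3 := hpath v
      rw [h1] at h3
      exact ((SimpleGraph.Walk.cons_isPath_iff h (path w)).1 h3).2 hv
    · right
      symm
      apply huniq
      exact (SimpleGraph.Walk.cons_isPath_iff h.symm (path v)).2 ⟨hpath v, hw⟩
  refine ⟨fun v a => path (c.nb v a) = .cons (adj_nb c v a).symm (path v),
    fun v => walkValue c y₀ Φ (path v), ?_, ?_, ?_, ?_⟩
  · have : path v₀ = .nil := (huniq v₀ _ (SimpleGraph.Walk.IsPath.nil)).symm
    simp only [this, walkValue]
  · intro v a
    rcases dich _ _ (adj_nb c v a) with h | h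
    · right
      have : ∀ w (hw : w = v) (h' : T.Adj w (c.nb v a)), path w = .cons h' (path (c.nb v a)) := by
        rintro w rfl h'
        exact h
      exact this _ (hc.nb_nb v a) _
    · exact Or.inl h
  · intro v a h
    simp only [h, walkValue, color_nb]
  · intro w hw
    have key : ∀ (p : T.Walk w v₀), p.IsPath → ∃ v a, path (c.nb v a) =
        .cons (adj_nb c v a).symm (path v) ∧ c.nb v a = w := by
      intro p hp
      cases p with
      | nil => exact absurd rfl hw
      | @cons _ v _ h q =>
        obtain ⟨a, rfl⟩ := exists_nb_eq c h.symm
        refine ⟨v, a, ?_, rfl⟩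
        rw [← huniq _ _ hp, ← huniq _ _ ((SimpleGraph.Walk.cons_isPath_iff h q).1 hp).1]
    exact key _ (hpath w)

/-! ### Automorphisms with prescribed local actions -/

/-- If the steps along the two directions of each edge are inverse to each other, then a function on
the vertices of a tree can be prescribed by its value at one vertex and the steps. -/
theorem exists_rec_of_reversible (hT : T.IsTree) (hc : c.IsLegal) {Y : Type*} (v₀ : V) (y₀ : Y)
    (Φ : X → V → Y → Y) (hΦ : ∀ v a y, Φ a (c.nb v a) (Φ a v y) = y) :
    ∃ f : V → Y, f v₀ = y₀ ∧ ∀ v a, f (c.nb v a) = Φ a v (f v) := by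
  obtain ⟨R, f, h0, hR, hf, -⟩ := exists_rec hT hc v₀ y₀ (fun v a y => Φ a v y)
  refine ⟨f, h0, fun v a => ?_⟩
  rcases hR v a with h | h
  · exact hf v a h
  · have h1 := hf _ _ h
    rw [hc.nb_nb] at h1
    rw [h1]
    have := hΦ (c.nb v a) a (f (c.nb v a))
    rw [hc.nb_nb] at this
    exact this.symm

/-- An assignment of permutations to the vertices that agrees along every edge on the color of that
edge is the family of local actions of an automorphism, which may be chosen to send a given vertex
to any other. -/
theorem exists_automorphism (hT : T.IsTree) (hc : c.IsLegal) (s : V → Equiv.Perm X)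
    (hs : ∀ v a, s (c.nb v a) a = s v a) (v₀ w₀ : V) :
    ∃ g : T ≃g T, g v₀ = w₀ ∧ ∀ v, localAction c g v = s v := by
  obtain ⟨f, hf0, hf⟩ := exists_rec_of_reversible hT hc v₀ w₀
    (fun a v x => c.nb x (s v a)) (fun v a y => by rw [hs, hc.nb_nb])
  obtain ⟨k, hk0, hk⟩ := exists_rec_of_reversible hT hc w₀ v₀
    (fun a _ x => c.nb x ((s x)⁻¹ a)) (fun v a y => by
      have : (s (c.nb y ((s y)⁻¹ a)))⁻¹ a = (s y)⁻¹ a := by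
        rw [Equiv.Perm.inv_eq_iff_eq, hs, Equiv.Perm.coe_inv, Equiv.apply_symm_apply]
      rw [this, hc.nb_nb])
  have hkf : ∀ v, k (f v) = v := by
    refine nb_induction c hT (v₀ := v₀) (by rw [hf0, hk0]) fun v a h => ?_
    rw [hf, hk, h, Equiv.Perm.coe_inv, Equiv.symm_apply_apply]
  have hfk : ∀ v, f (k v) = v := by
    refine nb_induction c hT (v₀ := w₀) (by rw [hk0, hf0]) fun v a h => ?_
    rw [hk, hf, h, Equiv.Perm.coe_inv, Equiv.apply_symm_apply]
  let e : V ≃ V := ⟨f, k, hkf, hfk⟩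
  have adj_f : ∀ v w, T.Adj v w → T.Adj (f v) (f w) := by
    intro v w h
    obtain ⟨a, rfl⟩ := exists_nb_eq c h
    rw [hf]
    exact adj_nb c _ _
  have adj_k : ∀ v w, T.Adj v w → T.Adj (k v) (k w) := by
    intro v w h
    obtain ⟨a, rfl⟩ := exists_nb_eq c h
    rw [hk]
    exact adj_nb c _ _
  let g : T ≃g T := ⟨e, fun {v w} => ⟨fun h => by
    have := adj_k _ _ h
    simpa [e, hkf] using this, adj_f v w⟩⟩
  exact ⟨g, hf0, fun v => localAction_eq fun a => hf v a⟩

theorem apply_mem_half_iff_of_fix (hT : T.IsTree) (hc : c.IsLegal) {g : T ≃g T} {v : V} {a : X}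
    (hv : g v = v) (ha : localAction c g v a = a) {u : V} :
    g u ∈ c.half v a ↔ u ∈ c.half v a := by
  have := apply_mem_half_iff hT hc g (v := v) (u := u) (a := a)
  rwa [hv, ha] at this

theorem localAction_apply_eq_self {g : T ≃g T} {v : V} {a : X} (hv : g v = v)
    (ha : g (c.nb v a) = c.nb v a) : localAction c g v a = a := by
  rw [apply_nb, hv] at ha
  exact nb_injective c v ha

/-- Gluing: automorphisms `g i` that fix the defining edges of pairwise disjoint half-trees combine
to an automorphism that acts on the `i`-th half-tree as `g i` and fixes all other vertices. -/
theorem exists_glue (hT : T.IsTree) (hc : c.IsLegal) {I : Type*} (v : I → V) (a : I → X)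
    (hd : Pairwise fun i j => Disjoint (c.half (v i) (a i)) (c.half (v j) (a j)))
    (g : I → T ≃g T) (hv : ∀ i, g i (v i) = v i)
    (ha : ∀ i, g i (c.nb (v i) (a i)) = c.nb (v i) (a i)) :
    ∃ x : T ≃g T, (∀ i, ∀ u ∈ c.half (v i) (a i), x u = g i u ∧
        localAction c x u = localAction c (g i) u) ∧
      ∀ u, (∀ i, u ∉ c.half (v i) (a i)) → x u = u ∧ localAction c x u = 1 := by
  classical
  have huniq : ∀ i j u, u ∈ c.half (v i) (a i) → u ∈ c.half (v j) (a j) → i = j := by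
    intro i j u hi hj
    by_contra hne
    exact Set.disjoint_left.1 (hd hne) hi hj
  have hpres : ∀ i u, g i u ∈ c.half (v i) (a i) ↔ u ∈ c.half (v i) (a i) := fun i u =>
    apply_mem_half_iff_of_fix hT hc (hv i) (localAction_apply_eq_self (hv i) (ha i))
  have hpres' : ∀ i u, (g i).symm u ∈ c.half (v i) (a i) ↔ u ∈ c.half (v i) (a i) := by
    intro i u
    rw [← hpres i, RelIso.apply_symm_apply]
  -- `F k` is the gluing of a family `k`; it is used for `g` and for the inverses
  obtain ⟨F, F_in, F_out⟩ : ∃ F : (I → V → V) → V → V,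
      (∀ k i u, u ∈ c.half (v i) (a i) → F k u = k i u) ∧
      ∀ k u, (∀ i, u ∉ c.half (v i) (a i)) → F k u = u := by
    refine ⟨fun k u => if h : ∃ i, u ∈ c.half (v i) (a i) then k h.choose u else u, ?_, ?_⟩
    · intro k i u hu
      have h : ∃ i, u ∈ c.half (v i) (a i) := ⟨i, hu⟩
      simp only [dif_pos h]
      rw [huniq _ _ _ h.choose_spec hu]
    · intro k u hu
      have h : ¬ ∃ i, u ∈ c.half (v i) (a i) := not_exists.2 hu
      simp only [dif_neg h]
  -- an edge crossing into a half-tree is fixed at both ends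
  have F_root : ∀ k : I → V → V, (∀ i, k i (c.nb (v i) (a i)) = c.nb (v i) (a i)) →
      (∀ i, k i (v i) = v i) → ∀ i, F k (v i) = v i := by
    intro k hk hk' i
    by_cases h : ∃ j, v i ∈ c.half (v j) (a j)
    · obtain ⟨j, hj⟩ := h
      rw [F_in k j _ hj]
      have hij : i ≠ j := by
        rintro rfl
        exact notMem_half c hT _ _ hj
      have h2 : c.nb (v i) (a i) ∉ c.half (v j) (a j) := fun h =>
        hij (huniq _ _ _ (nb_mem_half c _ _) h)
      obtain ⟨h3, -, -⟩ := eq_of_leaves_half hT hc hj h2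
      rw [h3, hk]
    · exact F_out k _ (not_exists.1 h)
  have F_nb : ∀ k : I → V → V, (∀ i, k i (c.nb (v i) (a i)) = c.nb (v i) (a i)) →
      (∀ i, k i (v i) = v i) → ∀ i u b, u ∈ c.half (v i) (a i) →
      F k (c.nb u b) = k i (c.nb u b) := by
    intro k hk hk' i u b hu
    by_cases hn : c.nb u b ∈ c.half (v i) (a i)
    · exact F_in k i _ hn
    · obtain ⟨-, h2, -⟩ := eq_of_leaves_half hT hc hu hn
      rw [h2, hk', F_root k hk hk']
  have F_nb' : ∀ k : I → V → V, (∀ i, k i (c.nb (v i) (a i)) = c.nb (v i) (a i)) →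
      (∀ i, k i (v i) = v i) → ∀ u b, (∀ i, u ∉ c.half (v i) (a i)) →
      F k (c.nb u b) = c.nb u b := by
    intro k hk hk' u b hu
    by_cases h : ∃ i, c.nb u b ∈ c.half (v i) (a i)
    · obtain ⟨i, hi⟩ := h
      have := eq_of_leaves_half hT hc (b := b) hi (by rw [hc.nb_nb]; exact hu i)
      rw [F_in k i _ hi, this.1, hk]
    · exact F_out k _ (not_exists.1 h)
  have F_adj : ∀ k : I → T ≃g T, (∀ i, k i (c.nb (v i) (a i)) = c.nb (v i) (a i)) →
      (∀ i, k i (v i) = v i) → ∀ u w, T.Adj u w →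
        T.Adj (F (fun i => k i) u) (F (fun i => k i) w) := by
    intro k hk hk' u w h
    obtain ⟨b, rfl⟩ := exists_nb_eq c h
    by_cases h' : ∃ i, u ∈ c.half (v i) (a i)
    · obtain ⟨i, hi⟩ := h'
      rw [F_nb _ hk hk' i u b hi, F_in _ i u hi]
      exact (k i).map_rel_iff.2 h
    · rw [F_nb' _ hk hk' u b (not_exists.1 h'), F_out _ u (not_exists.1 h')]
      exact h
  have hv' : ∀ i, (g i).symm (v i) = v i := fun i => (g i).symm_apply_eq.2 (hv i).symm
  have ha' : ∀ i, (g i).symm (c.nb (v i) (a i)) = c.nb (v i) (a i) := fun i =>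
    (g i).symm_apply_eq.2 (ha i).symm
  have inv1 : ∀ u, F (fun i => (g i).symm) (F (fun i => g i) u) = u := by
    intro u
    by_cases h : ∃ i, u ∈ c.half (v i) (a i)
    · obtain ⟨i, hi⟩ := h
      rw [F_in _ i u hi, F_in _ i _ ((hpres i u).2 hi), RelIso.symm_apply_apply]
    · rw [F_out _ u (not_exists.1 h), F_out _ u (not_exists.1 h)]
  have inv2 : ∀ u, F (fun i => g i) (F (fun i => (g i).symm) u) = u := by
    intro u
    by_cases h : ∃ i, u ∈ c.half (v i) (a i)
    · obtain ⟨i, hi⟩ := h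
      rw [F_in _ i u hi, F_in _ i _ ((hpres' i u).2 hi), RelIso.apply_symm_apply]
    · rw [F_out _ u (not_exists.1 h), F_out _ u (not_exists.1 h)]
  let x : T ≃g T := ⟨⟨F (fun i => g i), F (fun i => (g i).symm), inv1, inv2⟩, fun {u w} =>
    ⟨fun h => by
      have := F_adj (fun i => (g i).symm) ha' hv' _ _ h
      simpa [inv1] using this, F_adj g ha hv u w⟩⟩
  refine ⟨x, fun i u hu => ⟨F_in _ i u hu, localAction_congr (F_in _ i u hu)
    fun b => F_nb _ ha hv i u b hu⟩, fun u hu => ⟨F_out _ u hu, localAction_eq fun b => ?_⟩⟩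
  have h1 : x u = u := F_out _ u hu
  rw [h1]
  exact F_nb' _ ha hv u b hu

end Tree

section Elements

variable {V X : Type*} {T : SimpleGraph V} {c : Coloring T X} {F F' : Subgroup (Equiv.Perm X)}

/-! ### Rigid stabilizers of half-trees -/

theorem mem_restrictedBurgerMozes_of_forall (hFF' : F ≤ F') {g : T ≃g T}
    (hg : ∀ v, localAction c g v ∈ F) : g ∈ restrictedBurgerMozes c F F' := by
  refine ⟨fun v => hFF' (hg v), ?_⟩
  simp [hg]

/-- The group of color-preserving automorphisms. -/
def colorGroup (c : Coloring T X) : Subgroup (T ≃g T) where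
  carrier := {t | ∀ u, localAction c t u = 1}
  one_mem' := localAction_one c
  mul_mem' {s t} hs ht u := by rw [localAction_mul, hs, ht, one_mul]
  inv_mem' {t} ht u := by rw [localAction_inv, ht, inv_one]

theorem colorGroup_le (c : Coloring T X) (F F' : Subgroup (Equiv.Perm X)) :
    colorGroup c ≤ restrictedBurgerMozes c F F' := by
  intro t ht
  have h : ∀ u, localAction c t u = 1 := ht
  refine ⟨fun v => by rw [h]; exact one_mem _, ?_⟩
  simp [h, one_mem]

/-- The color-preserving automorphisms act transitively on the vertices. -/
theorem exists_mem_colorGroup (hT : T.IsTree) (hc : c.IsLegal) (v w : V) :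
    ∃ t ∈ colorGroup c, t v = w := by
  obtain ⟨t, h1, h2⟩ := exists_automorphism hT hc (fun _ => 1) (fun _ _ => rfl) v w
  exact ⟨t, h2, h1⟩

theorem localAction_conj {t : T ≃g T} (ht : t ∈ colorGroup c) (k : T ≃g T) (u : V) :
    localAction c (t * k * t⁻¹) u = localAction c k (t⁻¹ u) := by
  have ht' := inv_mem ht
  rw [localAction_mul, localAction_mul, ht, one_mul, ht', mul_one]

theorem apply_mem_half_colorGroup (hT : T.IsTree) (hc : c.IsLegal) {t : T ≃g T}
    (ht : t ∈ colorGroup c) {v u : V} {a : X} : t u ∈ c.half (t v) a ↔ u ∈ c.half v a := by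
  have := apply_mem_half_iff hT hc t (v := v) (u := u) (a := a)
  rwa [ht, Equiv.Perm.coe_one, id] at this

theorem perm_eq_one_of_forall_ne {s : Equiv.Perm X} (a : X) (h : ∀ b, b ≠ a → s b = b) :
    s = 1 := by
  ext b
  by_cases hb : b = a
  · subst hb
    by_contra hne
    exact hne (s.injective (h _ hne))
  · exact h b hb

variable (c F F') in
/-- The rigid stabilizer of a half-tree in `G(F, F')`: the elements that fix all vertices outside
it. -/
def rist (v : V) (a : X) : Subgroup (T ≃g T) where
  carrier := {k | k ∈ restrictedBurgerMozes c F F' ∧ ∀ u, u ∉ c.half v a → k u = u}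
  one_mem' := ⟨one_mem _, fun _ _ => rfl⟩
  mul_mem' {k l} hk hl := ⟨mul_mem hk.1 hl.1, fun u hu => by
    rw [RelIso.mul_apply, hl.2 u hu, hk.2 u hu]⟩
  inv_mem' {k} hk := ⟨inv_mem hk.1, fun u hu => k.symm_apply_eq.2 (hk.2 u hu).symm⟩

theorem rist_le (v : V) (a : X) : rist c F F' v a ≤ restrictedBurgerMozes c F F' := fun _ h => h.1

theorem rist_apply_origin (hT : T.IsTree) {v : V} {a : X} {k : T ≃g T}
    (hk : k ∈ rist c F F' v a) : k v = v := hk.2 v (notMem_half c hT v a)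

theorem rist_localAction_origin (hT : T.IsTree) (hc : c.IsLegal) {v : V} {a : X} {k : T ≃g T}
    (hk : k ∈ rist c F F' v a) : localAction c k v = 1 := by
  refine perm_eq_one_of_forall_ne a fun b hb => ?_
  refine localAction_apply_eq_self (rist_apply_origin hT hk) (hk.2 _ fun h => ?_)
  exact Set.disjoint_left.1 (half_disjoint_of_ne hT hc v hb) (nb_mem_half c v b) h

theorem rist_apply_root (hT : T.IsTree) (hc : c.IsLegal) {v : V} {a : X} {k : T ≃g T}
    (hk : k ∈ rist c F F' v a) : k (c.nb v a) = c.nb v a := by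
  rw [apply_nb, rist_localAction_origin hT hc hk, rist_apply_origin hT hk]
  rfl

theorem rist_localAction (hT : T.IsTree) (hc : c.IsLegal) {v u : V} {a : X} {k : T ≃g T}
    (hk : k ∈ rist c F F' v a) (hu : u ∉ c.half v a) : localAction c k u = 1 := by
  refine localAction_eq fun b => ?_
  rw [hk.2 u hu]
  by_cases hn : c.nb u b ∈ c.half v a
  · have := eq_of_leaves_half hT hc (b := b) hn (by rwa [hc.nb_nb])
    simp only [Equiv.Perm.coe_one, id]
    rw [this.1, rist_apply_root hT hc hk]
  · exact hk.2 _ hn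

theorem rist_mono (v w : V) (a b : X) (h : c.half v a ⊆ c.half w b) :
    rist c F F' v a ≤ rist c F F' w b :=
  fun _ hk => ⟨hk.1, fun u hu => hk.2 u fun hu' => hu (h hu')⟩

theorem rist_conj (hT : T.IsTree) (hc : c.IsLegal) {g k : T ≃g T} {v : V} {a : X}
    (hg : g ∈ restrictedBurgerMozes c F F') (hk : k ∈ rist c F F' v a) :
    g * k * g⁻¹ ∈ rist c F F' (g v) (localAction c g v a) := by
  refine ⟨mul_mem (mul_mem hg hk.1) (inv_mem hg), fun u hu => ?_⟩
  have h1 : g (g⁻¹ u) = u := g.apply_symm_apply u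
  rw [← h1, apply_mem_half_iff hT hc] at hu
  rw [RelIso.mul_apply, RelIso.mul_apply, hk.2 _ hu, h1]

theorem commute_of_disjoint {k l : T ≃g T} (hkl : ∀ u, k u = u ∨ l u = u) : k * l = l * k := by
  ext u
  rw [RelIso.mul_apply, RelIso.mul_apply]
  rcases hkl u with h | h
  · rcases hkl (l u) with h' | h'
    · rw [h', h]
    · rw [l.injective h', h, l.injective h']
  · rcases hkl (k u) with h' | h'
    · rw [k.injective h', h, k.injective h']
    · rw [h', h]

/-- Automorphisms supported in disjoint half-trees commute. -/
theorem rist_commute {v w : V} {a b : X} (h : Disjoint (c.half v a) (c.half w b)) {k l : T ≃g T}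
    (hk : k ∈ rist c F F' v a) (hl : l ∈ rist c F F' w b) : k * l = l * k := by
  refine commute_of_disjoint fun u => ?_
  by_cases hu : u ∈ c.half v a
  · exact Or.inr (hl.2 u (Set.disjoint_left.1 h hu))
  · exact Or.inl (hk.2 u hu)

/-- Edge independence: an element of `G(F, F')` that fixes both ends of an edge can be restricted to
the half-tree beyond the edge. -/
theorem exists_restrict (hT : T.IsTree) (hc : c.IsLegal) {g : T ≃g T} {v : V} {a : X}
    (hg : g ∈ restrictedBurgerMozes c F F') (hv : g v = v) (ha : g (c.nb v a) = c.nb v a) :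
    ∃ k ∈ rist c F F' v a, ∀ u ∈ c.half v a, k u = g u ∧ localAction c k u = localAction c g u := by
  obtain ⟨x, hx1, hx2⟩ := exists_glue hT hc (I := Unit) (fun _ => v) (fun _ => a)
    (fun i j hij => absurd rfl hij) (fun _ => g) (fun _ => hv) (fun _ => ha)
  have hx1 := hx1 ()
  have hx2 : ∀ u, u ∉ c.half v a → x u = u ∧ localAction c x u = 1 := fun u hu => hx2 u fun _ => hu
  refine ⟨x, ⟨⟨fun u => ?_, hg.2.subset fun u hu => ?_⟩, fun u hu => (hx2 u hu).1⟩, hx1⟩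
  · by_cases hu : u ∈ c.half v a
    · rw [(hx1 u hu).2]
      exact hg.1 u
    · rw [(hx2 u hu).2]
      exact one_mem _
  · by_cases hu' : u ∈ c.half v a
    · rwa [Set.mem_ofPred_eq, (hx1 u hu').2] at hu
    · rw [Set.mem_ofPred_eq, (hx2 u hu').2] at hu
      exact absurd (one_mem _) hu

/-- An element that fixes a vertex and all its neighbours is the product of its restrictions to the
half-trees at that vertex. -/
theorem mem_of_forall_restrict_mem [Finite X] (hT : T.IsTree) (hc : c.IsLegal)
    (Q : Subgroup (T ≃g T)) {g : T ≃g T} {v : V} (hg : g ∈ restrictedBurgerMozes c F F')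
    (hv : g v = v) (hl : localAction c g v = 1)
    (hQ : ∀ a, ∀ k ∈ rist c F F' v a,
      (∀ u ∈ c.half v a, localAction c k u = localAction c g u) → k ∈ Q) : g ∈ Q := by
  classical
  have := Fintype.ofFinite X
  have key : ∀ (s : Finset X) (g : T ≃g T), g ∈ restrictedBurgerMozes c F F' → g v = v →
      localAction c g v = 1 → (∀ a, a ∉ s → ∀ u ∈ c.half v a, g u = u) →
      (∀ a ∈ s, ∀ k ∈ rist c F F' v a,
        (∀ u ∈ c.half v a, localAction c k u = localAction c g u) → k ∈ Q) → g ∈ Q := by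
    intro s
    induction s using Finset.induction_on with
    | empty =>
      intro g _ hv _ hs _
      have : g = 1 := by
        ext u
        by_cases hu : u = v
        · rw [hu, hv]
          rfl
        · obtain ⟨a, ha⟩ := exists_mem_half hT hc hu
          exact hs a (Finset.notMem_empty a) u ha
      rw [this]
      exact one_mem _
    | insert a s has ih =>
      intro g hg hv hl hs hQ
      have hfix : ∀ b, g (c.nb v b) = c.nb v b := fun b => by
        rw [apply_nb, hl, hv]
        rfl
      obtain ⟨k, hk, hku⟩ := exists_restrict hT hc hg hv (hfix a)
      have hkQ : k ∈ Q := hQ a (Finset.mem_insert_self a s) k hk fun u hu => (hku u hu).2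
      have hout : ∀ b, b ≠ a → ∀ u ∈ c.half v b, g u ∉ c.half v a := by
        intro b hb u hu
        refine Set.disjoint_left.1 (half_disjoint_of_ne hT hc v hb) ?_
        rwa [apply_mem_half_iff_of_fix hT hc hv (by rw [hl]; rfl)]
      have hk' := inv_mem hk
      have hmem : k⁻¹ * g ∈ Q := by
        refine ih (k⁻¹ * g) (mul_mem hk'.1 hg) ?_ ?_ ?_ ?_
        · rw [RelIso.mul_apply, hv, rist_apply_origin hT hk']
        · rw [localAction_mul, hv, hl, rist_localAction_origin hT hc hk', one_mul]
        · intro b hb u hu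
          by_cases hba : b = a
          · subst hba
            rw [RelIso.mul_apply, ← (hku u hu).1]
            exact k.symm_apply_apply u
          · rw [RelIso.mul_apply, hk'.2 _ (hout b hba u hu)]
            exact hs b (by simp [hba, hb]) u hu
        · intro b hb l hlb hlu
          have hba : b ≠ a := fun h => has (h ▸ hb)
          refine hQ b (Finset.mem_insert_of_mem hb) l hlb fun u hu => ?_
          rw [hlu u hu, localAction_mul, rist_localAction hT hc hk' (hout b hba u hu), one_mul]
      have := mul_mem hkQ hmem
      rwa [mul_inv_cancel_left] at this
  exact key Finset.univ g hg hv hl (fun a ha => absurd (Finset.mem_univ a) ha) fun a _ => hQ a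

/-! ### Elements with one exceptional vertex -/

theorem exists_mem_apply_eq {τ : Equiv.Perm X} (hτ : τ ∈ orbitYoungGroup F) (x : X) :
    ∃ f ∈ F, f x = τ x := by
  have h := hτ {y | MulAction.orbitRel F X y x} ⟨x, rfl⟩
  have h1 : τ x ∈ τ '' {y | MulAction.orbitRel F X y x} :=
    ⟨x, (MulAction.orbitRel F X).refl x, rfl⟩
  rw [h] at h1
  obtain ⟨f, hf⟩ := MulAction.orbitRel_apply.1 h1
  exact ⟨f.1, f.2, hf⟩

/-- Every permutation in `F'` is the local action at `v` of an element of `G(F, F')` that fixes `v`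
and has no other vertex with local action outside `F`. -/
theorem exists_localAction_eq (hT : T.IsTree) (hc : c.IsLegal) (hFF' : F ≤ F')
    (hY : F' ≤ orbitYoungGroup F) {τ : Equiv.Perm X} (hτ : τ ∈ F') (v : V) :
    ∃ s ∈ restrictedBurgerMozes c F F', s v = v ∧ localAction c s v = τ ∧
      ∀ u, u ≠ v → localAction c s u ∈ F := by
  choose f hfF hf using fun (σ : F') (x : X) => exists_mem_apply_eq (hY σ.2) x
  obtain ⟨R, s, hs0, hR, hs, hch⟩ := exists_rec hT hc v (⟨τ, hτ⟩ : F')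
    (fun _ a σ => ⟨f σ a, hFF' (hfF σ a)⟩)
  obtain ⟨g, hgv, hg⟩ := exists_automorphism hT hc (fun u => (s u : Equiv.Perm X)) (by
    intro u a
    rcases hR u a with h | h
    · simp only [hs u a h, hf]
    · have := hs _ _ h
      rw [hc.nb_nb] at this
      simp only [this, hf]) v v
  have hF : ∀ u, u ≠ v → localAction c g u ∈ F := by
    intro u hu
    obtain ⟨w, a, hw, rfl⟩ := hch u hu
    rw [hg, hs w a hw]
    exact hfF _ _
  refine ⟨g, ⟨fun u => by rw [hg]; exact (s u).2, (Set.finite_singleton v).subset ?_⟩, hgv,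
    by rw [hg, hs0], hF⟩
  intro u hu
  by_contra hne
  exact hu (hF u hne)

/-- Permutations in `F'` fixing the color `a` occur as local actions at `v` of elements supported on
the side of `v` of the edge of color `a`. -/
theorem exists_rist_localAction_eq (hT : T.IsTree) (hc : c.IsLegal) (hFF' : F ≤ F')
    (hY : F' ≤ orbitYoungGroup F) {τ : Equiv.Perm X} (hτ : τ ∈ F') (v : V) {a : X}
    (ha : τ a = a) :
    ∃ k ∈ rist c F F' (c.nb v a) a, k v = v ∧ localAction c k v = τ := by
  obtain ⟨s, hs, hsv, hsl, -⟩ := exists_localAction_eq hT hc hFF' hY hτ v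
  obtain ⟨k, hk, hku⟩ := exists_restrict hT hc (v := c.nb v a) (a := a) hs
    (by rw [apply_nb, hsv, hsl, ha]) (by rw [hc.nb_nb, hsv])
  have hv : v ∈ c.half (c.nb v a) a := (mem_half_nb_iff hT hc).2 (notMem_half c hT v a)
  exact ⟨k, hk, by rw [(hku v hv).1, hsv], by rw [(hku v hv).2, hsl]⟩

/-! ### A translation and infinite products -/

/-- A color-preserving translation whose axis avoids the edges of color `a`, together with the
images of a half-tree hanging off the axis: they are pairwise disjoint. -/
theorem exists_translation (hT : T.IsTree) (hc : c.IsLegal) (v : V) {a b e : X} (hab : a ≠ b)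
    (hae : a ≠ e) (hbe : b ≠ e) :
    ∃ t ∈ colorGroup c, t v = c.nb (c.nb v b) e ∧
      ∀ i j : ℕ, i < j → Disjoint (c.half ((t ^ i) v) a) (c.half ((t ^ j) v) a) := by
  obtain ⟨t, ht, htv⟩ := exists_mem_colorGroup hT hc v (c.nb (c.nb v b) e)
  refine ⟨t, ht, htv, ?_⟩
  have sub : ∀ x, x ≠ e → c.half (t v) x ⊆ c.half v b := by
    intro x hx
    rw [htv]
    exact (half_nb_subset hT hc _ hx).trans (half_nb_subset hT hc _ hbe.symm)
  have key : ∀ n : ℕ, c.half ((t ^ (n + 1)) v) a ⊆ c.half v b := by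
    intro n
    induction n with
    | zero => simpa using sub a hae
    | succ n ih =>
      intro u hu
      have h1 : t (t⁻¹ u) = u := t.apply_symm_apply u
      rw [pow_succ', RelIso.mul_apply, ← h1, apply_mem_half_colorGroup hT hc ht] at hu
      refine sub b hbe ?_
      rw [← h1, apply_mem_half_colorGroup hT hc ht]
      exact ih hu
  intro i j hij
  obtain ⟨n, rfl⟩ := Nat.exists_eq_add_of_lt hij
  rw [Set.disjoint_left]
  intro u hu hu'
  have hti := pow_mem ht i
  have h1 : (t ^ i) ((t ^ i)⁻¹ u) = u := (t ^ i).apply_symm_apply u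
  rw [← h1, apply_mem_half_colorGroup hT hc hti] at hu
  rw [add_assoc, pow_add, RelIso.mul_apply, ← h1, apply_mem_half_colorGroup hT hc hti] at hu'
  exact Set.disjoint_left.1 (half_disjoint_of_ne hT hc v hab) hu (key n hu')

theorem infinite_of_rist_le (hT : T.IsTree) (hc : c.IsLegal) {v : V} {a b e : X} (hab : a ≠ b)
    (hae : a ≠ e) (hbe : b ≠ e) {k : T ≃g T} (hk : k ∈ rist c F F' v a) (hk1 : k ≠ 1)
    {P : Subgroup (T ≃g T)} (hP : ∀ w, rist c F F' w a ≤ P) : Infinite P := by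
  obtain ⟨t, ht, -, hd⟩ := exists_translation hT hc v hab hae hbe
  have hmem : ∀ i : ℕ, t ^ i * k * (t ^ i)⁻¹ ∈ rist c F F' ((t ^ i) v) a := by
    intro i
    have hti := pow_mem ht i
    have := rist_conj hT hc (colorGroup_le c F F' hti) hk
    rwa [hti, Equiv.Perm.coe_one, id] at this
  have hne : ∀ i j : ℕ, i < j → t ^ i * k * (t ^ i)⁻¹ ≠ t ^ j * k * (t ^ j)⁻¹ := by
    intro i j hij heq
    have h1 : t ^ i * k * (t ^ i)⁻¹ = 1 := by
      ext u
      by_cases hu : u ∈ c.half ((t ^ i) v) a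
      · rw [heq]
        exact (hmem j).2 u (Set.disjoint_left.1 (hd i j hij) hu)
      · exact (hmem i).2 u hu
    exact hk1 (conj_eq_one_iff.1 h1)
  refine Infinite.of_injective (fun i : ℕ => (⟨_, hP _ (hmem i)⟩ : P)) fun i j hij => ?_
  have hij' := congrArg Subtype.val hij
  by_contra h
  rcases lt_or_gt_of_ne h with h | h
  · exact hne i j h hij'
  · exact hne j i h hij'.symm

/-- An element of a rigid stabilizer with all local actions in `F` is the commutator of the infinite
product of its translates with the translation. The infinite product lies in `G(F, F')` because the
translation preserves colors. -/
theorem exists_commutator_eq (hT : T.IsTree) (hc : c.IsLegal) (hFF' : F ≤ F') {v : V} {a : X}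
    {t : T ≃g T} (ht : t ∈ colorGroup c)
    (hd : ∀ i j : ℕ, i < j → Disjoint (c.half ((t ^ i) v) a) (c.half ((t ^ j) v) a))
    {k : T ≃g T} (hk : k ∈ rist c F F' v a) (hkF : ∀ u, localAction c k u ∈ F) :
    ∃ x ∈ restrictedBurgerMozes c F F', ⁅x, t⁆ = k ∧ x (c.nb v a) = c.nb v a := by
  have hti : ∀ i : ℕ, t ^ i ∈ colorGroup c := fun i => pow_mem ht i
  have hmem : ∀ i : ℕ, t ^ i * k * (t ^ i)⁻¹ ∈ rist c F F' ((t ^ i) v) a := by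
    intro i
    have := rist_conj hT hc (colorGroup_le c F F' (hti i)) hk
    rwa [hti i, Equiv.Perm.coe_one, id] at this
  have hd' : Pairwise fun i j : ℕ => Disjoint (c.half ((t ^ i) v) a) (c.half ((t ^ j) v) a) := by
    intro i j hij
    rcases lt_or_gt_of_ne hij with h | h
    · exact hd i j h
    · exact (hd j i h).symm
  obtain ⟨x, hx1, hx2⟩ := exists_glue hT hc (fun i : ℕ => (t ^ i) v) (fun _ => a) hd'
    (fun i => t ^ i * k * (t ^ i)⁻¹) (fun i => rist_apply_origin hT (hmem i))
    (fun i => rist_apply_root hT hc (hmem i))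
  have hroot : x (c.nb v a) = c.nb v a := by
    rw [(hx1 0 _ (by simpa using nb_mem_half c v a)).1]
    simpa using rist_apply_root hT hc hk
  refine ⟨x, mem_restrictedBurgerMozes_of_forall hFF' fun u => ?_, ?_, hroot⟩
  · by_cases h : ∃ i : ℕ, u ∈ c.half ((t ^ i) v) a
    · obtain ⟨i, hi⟩ := h
      rw [(hx1 i u hi).2, localAction_conj (hti i)]
      exact hkF _
    · rw [(hx2 u (not_exists.1 h)).2]
      exact one_mem _
  · rw [commutatorElement_def, mul_inv_eq_iff_eq_mul, mul_inv_eq_iff_eq_mul]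
    -- the product of the translates satisfies `x = k * (t * x * t⁻¹)`
    suffices h : ∀ w, x (t w) = k (t (x w)) by
      ext w
      exact h w
    have shift : ∀ (i : ℕ) w, t w ∈ c.half ((t ^ (i + 1)) v) a ↔ w ∈ c.half ((t ^ i) v) a := by
      intro i w
      rw [pow_succ', RelIso.mul_apply, apply_mem_half_colorGroup hT hc ht]
    intro w
    by_cases h : ∃ i : ℕ, w ∈ c.half ((t ^ i) v) a
    · obtain ⟨i, hi⟩ := h
      have h1 : t ((t ^ i * k * (t ^ i)⁻¹) w) = (t ^ (i + 1) * k * (t ^ (i + 1))⁻¹) (t w) := by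
        rw [← RelIso.mul_apply, ← RelIso.mul_apply]
        congr 1
        rw [pow_succ']
        group
      have h2 : (t ^ (i + 1) * k * (t ^ (i + 1))⁻¹) (t w) ∈ c.half ((t ^ (i + 1)) v) a := by
        rw [apply_mem_half_iff_of_fix hT hc (rist_apply_origin hT (hmem (i + 1)))
          (by rw [rist_localAction_origin hT hc (hmem (i + 1))]; rfl)]
        exact (shift i w).2 hi
      rw [(hx1 i w hi).1, h1, (hx1 (i + 1) _ ((shift i w).2 hi)).1, hk.2]
      have h3 := hd 0 (i + 1) (Nat.succ_pos i)
      rw [pow_zero] at h3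
      exact fun h4 => Set.disjoint_left.1 h3 h4 h2
    · rw [(hx2 w (not_exists.1 h)).1]
      by_cases h0 : t w ∈ c.half v a
      · have h0' : t w ∈ c.half ((t ^ 0) v) a := by simpa using h0
        rw [(hx1 0 _ h0').1]
        simp
      · rw [hk.2 _ h0]
        refine (hx2 _ fun i hi => ?_).1
        cases i with
        | zero => exact h0 (by simpa using hi)
        | succ i => exact h ⟨i, (shift i w).1 hi⟩

end Elements

section Necessity

variable {V X : Type*} {T : SimpleGraph V} {c : Coloring T X} {F F' : Subgroup (Equiv.Perm X)}

/-! ### The subgroup generated by the rigid stabilizers -/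

variable (c F F') in
/-- The subgroup of `G(F, F')` generated by the rigid stabilizers of all half-trees. By edge
independence it is also generated by the pointwise fixators of edges. -/
def ristGroup : Subgroup (T ≃g T) := ⨆ v, ⨆ a, rist c F F' v a

theorem rist_le_ristGroup (v : V) (a : X) : rist c F F' v a ≤ ristGroup c F F' :=
  le_iSup_of_le v (le_iSup (fun a => rist c F F' v a) a)

theorem ristGroup_le_iff {Q : Subgroup (T ≃g T)} :
    ristGroup c F F' ≤ Q ↔ ∀ v a, rist c F F' v a ≤ Q := by
  simp [ristGroup]

theorem ristGroup_le : ristGroup c F F' ≤ restrictedBurgerMozes c F F' :=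
  ristGroup_le_iff.2 fun v a => rist_le v a

theorem ristGroup_conj (hT : T.IsTree) (hc : c.IsLegal) {g p : T ≃g T}
    (hg : g ∈ restrictedBurgerMozes c F F') (hp : p ∈ ristGroup c F F') :
    g * p * g⁻¹ ∈ ristGroup c F F' := by
  have : ristGroup c F F' ≤ (ristGroup c F F').comap (MulAut.conj g).toMonoidHom :=
    ristGroup_le_iff.2 fun v a k hk => rist_le_ristGroup _ _ (rist_conj hT hc hg hk)
  exact this hp

/-- The local actions at the two ends of an edge agree on the color of the edge. -/
theorem localAction_nb (hc : c.IsLegal) (g : T ≃g T) (v : V) (a : X) :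
    localAction c g (c.nb v a) a = localAction c g v a := by
  have h := apply_nb c g (c.nb v a) a
  rw [hc.nb_nb] at h
  have h2 := apply_nb c g v a
  have h3 := hc.nb_nb (g (c.nb v a)) (localAction c g (c.nb v a) a)
  rw [← h] at h3
  exact nb_injective c _ (h3.trans h2)

/-! ### Necessity -/

/-- An infinite normal subgroup of a virtually simple group has finite index. -/
theorem VirtuallySimple.finiteIndex_of_infinite {G : Type*} [Group G] (hG : VirtuallySimple G)
    (N : Subgroup G) [hN : N.Normal] [Infinite N] : N.FiniteIndex := by
  obtain ⟨H, hH, hs⟩ := hG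
  rcases (hN.subgroupOf H).eq_bot_or_eq_top with h | h
  · rw [Subgroup.subgroupOf_eq_bot] at h
    have : Finite (G ⧸ H) := Subgroup.finite_quotient_of_finiteIndex
    refine absurd (Finite.of_injective (fun n : N => (QuotientGroup.mk n.1 : G ⧸ H)) ?_)
      (not_finite_iff_infinite.2 inferInstance)
    intro n m hnm
    have h1 : n.1⁻¹ * m.1 ∈ H := QuotientGroup.eq.1 hnm
    have h2 := Subgroup.disjoint_def.1 h (mul_mem (inv_mem n.2) m.2) h1
    exact Subtype.ext (inv_mul_eq_one.1 h2)
  · rw [Subgroup.subgroupOf_eq_top] at h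
    exact Subgroup.finiteIndex_of_le h

/-- The local actions of elements of `ristGroup` lie in the subgroup of `F'` generated by its point
stabilizers, because local actions at adjacent vertices agree on the color of the edge. -/
theorem localAction_mem_of_mem_ristGroup (hT : T.IsTree) (hc : c.IsLegal)
    {E : Subgroup (Equiv.Perm X)} (hE : ∀ σ ∈ F', ∀ x, σ x = x → σ ∈ E) {p : T ≃g T}
    (hp : p ∈ ristGroup c F F') (u : V) : localAction c p u ∈ E := by
  have : ristGroup c F F' ≤ restrictedBurgerMozes c E E := by
    refine ristGroup_le_iff.2 fun v a k hk => mem_restrictedBurgerMozes_of_forall le_rfl ?_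
    refine nb_induction c hT (v₀ := v) ?_ fun u b hu => ?_
    · rw [rist_localAction_origin hT hc hk]
      exact one_mem _
    · have h1 : (localAction c k u)⁻¹ * localAction c k (c.nb u b) ∈ E := by
        refine hE _ (mul_mem (inv_mem (hk.1.1 u)) (hk.1.1 _)) b ?_
        rw [Equiv.Perm.mul_apply, localAction_nb hc, Equiv.Perm.inv_eq_iff_eq]
      have := mul_mem hu h1
      rwa [mul_inv_cancel_left] at this
  exact (this hp).1 u

/-- A function on the vertices whose value at a neighbour is determined by its value at the vertex
and the class of the color of the edge is invariant under `ristGroup`. -/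
theorem eq_of_mem_ristGroup (hT : T.IsTree) (hc : c.IsLegal) {Y : Type*}
    {f : V → Y} {step : X → Y → Y} (hf : ∀ v a, f (c.nb v a) = step a (f v))
    {E : Subgroup (Equiv.Perm X)} (hE : ∀ σ ∈ F', ∀ x, σ x = x → σ ∈ E)
    (hstep : ∀ σ ∈ E, ∀ a, step (σ a) = step a) {p : T ≃g T}
    (hp : p ∈ ristGroup c F F') (u : V) : f (p u) = f u := by
  let Q : Subgroup (T ≃g T) :=
    { carrier := {g | ∀ u, f (g u) = f u}
      one_mem' := fun _ => rfl
      mul_mem' := fun {g h} hg hh u => (hg (h u)).trans (hh u)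
      inv_mem' := fun {g} hg u => by
        have := hg (g⁻¹ u)
        rw [← RelIso.mul_apply, mul_inv_cancel] at this
        exact this.symm }
  have : ristGroup c F F' ≤ Q := by
    refine ristGroup_le_iff.2 fun v a k hk => ?_
    refine nb_induction c hT (v₀ := v) ?_ fun u b hu => ?_
    · rw [rist_apply_origin hT hk]
    · rw [apply_nb, hf, hf, hu,
        hstep _ (localAction_mem_of_mem_ristGroup hT hc hE (rist_le_ristGroup v a hk) u)]
  exact this hp u

theorem normal_subgroupOf {G H : Subgroup (T ≃g T)}
    (h : ∀ g ∈ G, ∀ k ∈ H, g * k * g⁻¹ ∈ H) : (H.subgroupOf G).Normal :=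
  ⟨fun k hk g => h g.1 g.2 k.1 hk⟩

open Classical in
/-- One step in the Cayley graph of the infinite dihedral group, a line with vertex set `ℤ` whose
edges belong alternately to the two generating reflections. -/
noncomputable def lineStep (A : Set X) (a : X) (n : ℤ) : ℤ :=
  if (a ∈ A ↔ Even n) then n + 1 else n - 1

theorem lineStep_lineStep (A : Set X) (a : X) (n : ℤ) :
    lineStep A a (lineStep A a n) = n := by
  unfold lineStep
  by_cases h1 : a ∈ A <;> by_cases h2 : Even n <;> simp [h1, h2, parity_simps]

/-- If `ristGroup` has finite index, then any subgroup of `F'` that contains the point stabilizers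
is transitive: an invariant partition into two parts would give an equivariant map of the tree onto
the Cayley graph of the infinite dihedral group, whose fibres `ristGroup` preserves. -/
theorem exists_apply_eq_of_finiteIndex (hT : T.IsTree) (hc : c.IsLegal)
    (hfin : ((ristGroup c F F').subgroupOf (restrictedBurgerMozes c F F')).FiniteIndex)
    {E : Subgroup (Equiv.Perm X)} (hE : ∀ σ ∈ F', ∀ x, σ x = x → σ ∈ E) (a b : X) :
    ∃ σ ∈ E, σ a = b := by
  by_contra hab
  push Not at hab
  let A : Set X := {x | ∃ σ ∈ E, σ a = x}
  have haA : a ∈ A := ⟨1, one_mem _, rfl⟩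
  have hbA : b ∉ A := fun ⟨σ, hσ, h⟩ => hab σ hσ h
  have hEA : ∀ σ ∈ E, ∀ x, σ x ∈ A ↔ x ∈ A := by
    refine fun σ hσ x => ⟨fun ⟨ρ, hρ, h⟩ => ⟨σ⁻¹ * ρ, mul_mem (inv_mem hσ) hρ, ?_⟩,
      fun ⟨ρ, hρ, h⟩ => ⟨σ * ρ, mul_mem hσ hρ, ?_⟩⟩
    · rw [Equiv.Perm.mul_apply, h, Equiv.Perm.inv_eq_iff_eq]
    · rw [Equiv.Perm.mul_apply, h]
  have hstep : ∀ σ ∈ E, ∀ x, lineStep A (σ x) = lineStep A x := by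
    intro σ hσ x
    funext n
    have h := propext (hEA σ hσ x)
    unfold lineStep
    rw [h]
  obtain ⟨v₀⟩ := hT.connected.nonempty
  obtain ⟨f, hf0, hf⟩ := exists_rec_of_reversible hT hc v₀ (0 : ℤ)
    (fun x _ n => lineStep A x n) (fun _ x n => lineStep_lineStep A x n)
  have hsurj : ∀ n : ℕ, ∃ v, f v = n := by
    intro n
    induction n with
    | zero => exact ⟨v₀, by simpa using hf0⟩
    | succ n ih =>
      obtain ⟨v, hv⟩ := ih
      by_cases hn : Even (n : ℤ)
      · exact ⟨c.nb v a, by rw [hf, hv]; simp [lineStep, haA, hn]⟩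
      · exact ⟨c.nb v b, by rw [hf, hv]; simp [lineStep, hbA, hn]⟩
  choose w hw using hsurj
  choose t ht htw using fun n => exists_mem_colorGroup (c := c) hT hc v₀ (w n)
  have hinj : Function.Injective fun n : ℕ =>
      (QuotientGroup.mk (⟨t n, colorGroup_le c F F' (ht n)⟩ : restrictedBurgerMozes c F F') :
        restrictedBurgerMozes c F F' ⧸
          (ristGroup c F F').subgroupOf (restrictedBurgerMozes c F F')) := by
    intro n m hnm
    have hp : (t n)⁻¹ * t m ∈ ristGroup c F F' := by
      simp only [QuotientGroup.eq] at hnm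
      exact hnm
    have h1 := eq_of_mem_ristGroup hT hc (f := fun v => f (t n v)) (step := lineStep A)
      (fun v x => by rw [apply_nb, ht n, Equiv.Perm.coe_one, id, hf]) hE hstep hp v₀
    rw [← RelIso.mul_apply, mul_inv_cancel_left, htw, htw, hw, hw] at h1
    exact_mod_cast h1.symm
  have := Finite.of_injective _ hinj
  exact not_finite ℕ

theorem transitive_and_generated_of_virtuallySimple (hT : T.IsTree) (hc : c.IsLegal)
    (hX : ∀ a b : X, ∃ e, e ≠ a ∧ e ≠ b) (hFF' : F ≤ F') (hY : F' ≤ orbitYoungGroup F)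
    (hfree : ¬ ActsFreely F') (hG : VirtuallySimple (restrictedBurgerMozes c F F')) :
    MulAction.IsPretransitive F' X ∧ GeneratedByPointStabilizers F' := by
  obtain ⟨x, hx⟩ := not_forall.1 hfree
  obtain ⟨τ, hτ1⟩ := Subgroup.ne_bot_iff_exists_ne_one.1 hx
  obtain ⟨v⟩ := hT.connected.nonempty
  obtain ⟨b, hb, -⟩ := hX x x
  obtain ⟨e, hex, heb⟩ := hX x b
  have hτx : τ.1.1 x = x := τ.2
  have hτ1' : τ.1.1 ≠ 1 := fun h => hτ1 (Subtype.ext (Subtype.ext h))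
  have hinf : Infinite (ristGroup c F F') := by
    obtain ⟨k, hk, -, hkl⟩ := exists_rist_localAction_eq (c := c) hT hc hFF' hY τ.1.2 v hτx
    refine infinite_of_rist_le hT hc hb.symm hex.symm heb.symm hk ?_
      fun w => rist_le_ristGroup w x
    rintro rfl
    rw [localAction_one] at hkl
    exact hτ1' hkl.symm
  have hfin : ((ristGroup c F F').subgroupOf (restrictedBurgerMozes c F F')).FiniteIndex := by
    have := normal_subgroupOf (G := restrictedBurgerMozes c F F') (H := ristGroup c F F')
      fun g hg k hk => ristGroup_conj hT hc hg hk
    have : Infinite ((ristGroup c F F').subgroupOf (restrictedBurgerMozes c F F')) :=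
      (Subgroup.subgroupOfEquivOfLe ristGroup_le).toEquiv.infinite_iff.2 hinf
    exact hG.finiteIndex_of_infinite _
  have hmem : ∀ σ ∈ F', ∀ y, σ y = y →
      σ ∈ (⨆ x : X, MulAction.stabilizer F' x).map F'.subtype := by
    intro σ hσ y hy
    exact ⟨⟨σ, hσ⟩, Subgroup.mem_iSup_of_mem y hy, rfl⟩
  have htrans := exists_apply_eq_of_finiteIndex hT hc hfin hmem
  refine ⟨⟨fun y z => ?_⟩, ?_⟩
  · obtain ⟨_, ⟨σ, -, rfl⟩, h⟩ := htrans y z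
    exact ⟨σ, h⟩
  · refine eq_top_iff.2 fun ρ _ => ?_
    obtain ⟨_, ⟨σ, hσ, rfl⟩, h⟩ := htrans x (ρ.1 x)
    have h1 : σ⁻¹ * ρ ∈ ⨆ x : X, MulAction.stabilizer F' x := by
      refine Subgroup.mem_iSup_of_mem x ?_
      rw [MulAction.mem_stabilizer_iff, mul_smul, inv_smul_eq_iff]
      exact h.symm
    have := mul_mem hσ h1
    rwa [mul_inv_cancel_left] at this

end Necessity

section Sufficiency

variable {V X : Type*} {T : SimpleGraph V} {c : Coloring T X} {F F' : Subgroup (Equiv.Perm X)}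

/-! ### The simple subgroup and its orbits -/

variable (c F F') in
/-- The subgroup of `G(F, F')` generated by the commutator subgroups of the rigid stabilizers of
half-trees. -/
def ristCommutator : Subgroup (T ≃g T) := ⨆ v, ⨆ a, ⁅rist c F F' v a, rist c F F' v a⁆

theorem ristCommutator_le_iff {Q : Subgroup (T ≃g T)} : ristCommutator c F F' ≤ Q ↔
    ∀ v a, ∀ k ∈ rist c F F' v a, ∀ l ∈ rist c F F' v a, ⁅k, l⁆ ∈ Q := by
  simp only [ristCommutator, iSup_le_iff, Subgroup.commutator_le]

theorem commutator_mem_ristCommutator {v : V} {a : X} {k l : T ≃g T} (hk : k ∈ rist c F F' v a)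
    (hl : l ∈ rist c F F' v a) : ⁅k, l⁆ ∈ ristCommutator c F F' :=
  ristCommutator_le_iff.1 le_rfl v a k hk l hl

theorem commutator_mem {G : Type*} [Group G] {H : Subgroup G} {g h : G} (hg : g ∈ H) (hh : h ∈ H) :
    ⁅g, h⁆ ∈ H := by
  rw [commutatorElement_def]
  exact mul_mem (mul_mem (mul_mem hg hh) (inv_mem hg)) (inv_mem hh)

theorem ristCommutator_le_ristGroup : ristCommutator c F F' ≤ ristGroup c F F' :=
  ristCommutator_le_iff.2 fun v a _ hk _ hl =>
    commutator_mem (rist_le_ristGroup v a hk) (rist_le_ristGroup v a hl)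

theorem ristCommutator_le : ristCommutator c F F' ≤ restrictedBurgerMozes c F F' :=
  ristCommutator_le_ristGroup.trans ristGroup_le

theorem ristCommutator_conj (hT : T.IsTree) (hc : c.IsLegal) {g p : T ≃g T}
    (hg : g ∈ restrictedBurgerMozes c F F') (hp : p ∈ ristCommutator c F F') :
    g * p * g⁻¹ ∈ ristCommutator c F F' := by
  have : ristCommutator c F F' ≤ (ristCommutator c F F').comap (MulAut.conj g).toMonoidHom := by
    refine ristCommutator_le_iff.2 fun v a k hk l hl => ?_
    change g * ⁅k, l⁆ * g⁻¹ ∈ ristCommutator c F F'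
    rw [conjugate_commutatorElement]
    exact commutator_mem_ristCommutator (rist_conj hT hc hg hk) (rist_conj hT hc hg hl)
  exact this hp

/-- A subgroup of automorphisms that is transitive on the edges at every vertex has at most two
orbits on vertices, represented by the two ends of any edge. -/
theorem exists_apply_eq_or (hT : T.IsTree) (hc : c.IsLegal) {H : Subgroup (T ≃g T)}
    (hH : ∀ w a b, ∃ h ∈ H, h w = w ∧ h (c.nb w a) = c.nb w b) (v : V) (a : X) (u : V) :
    (∃ h ∈ H, h v = u) ∨ ∃ h ∈ H, h (c.nb v a) = u := by
  refine nb_induction c hT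
    (p := fun u => (∃ h ∈ H, h v = u) ∨ ∃ h ∈ H, h (c.nb v a) = u) (v₀ := v)
    (Or.inl ⟨1, one_mem _, rfl⟩) (fun u b hu => ?_) u
  rcases hu with ⟨h, hh, rfl⟩ | ⟨h, hh, rfl⟩
  · right
    obtain ⟨l, hl, -, hl2⟩ := hH v a ((localAction c h v)⁻¹ b)
    refine ⟨h * l, mul_mem hh hl, ?_⟩
    rw [RelIso.mul_apply, hl2, apply_nb, Equiv.Perm.coe_inv, Equiv.apply_symm_apply]
  · left
    obtain ⟨l, hl, -, hl2⟩ := hH (c.nb v a) a ((localAction c h (c.nb v a))⁻¹ b)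
    refine ⟨h * l, mul_mem hh hl, ?_⟩
    rw [hc.nb_nb] at hl2
    rw [RelIso.mul_apply, hl2, apply_nb, Equiv.Perm.coe_inv, Equiv.apply_symm_apply]

variable (c F F') in
/-- The elements of `G(F, F')` that fix `v` and whose local actions away from `v` lie in `F`. -/
def single (v : V) : Subgroup (T ≃g T) where
  carrier := {g | g ∈ restrictedBurgerMozes c F F' ∧ g v = v ∧ ∀ u, u ≠ v → localAction c g u ∈ F}
  one_mem' := ⟨one_mem _, rfl, fun u _ => by rw [localAction_one]; exact one_mem _⟩
  mul_mem' := by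
    rintro g h ⟨hg, hgv, hgF⟩ ⟨hh, hhv, hhF⟩
    refine ⟨mul_mem hg hh, by rw [RelIso.mul_apply, hhv, hgv], fun u hu => ?_⟩
    rw [localAction_mul]
    refine mul_mem (hgF _ fun h' => hu ?_) (hhF u hu)
    rw [← hhv] at h'
    exact h.injective h'
  inv_mem' := by
    rintro g ⟨hg, hgv, hgF⟩
    refine ⟨inv_mem hg, g.symm_apply_eq.2 hgv.symm, fun u hu => ?_⟩
    rw [localAction_inv]
    refine inv_mem (hgF _ fun h' => hu ?_)
    rw [← hgv, ← h']
    exact (g.apply_symm_apply u).symm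

theorem single_le (v : V) : single c F F' v ≤ restrictedBurgerMozes c F F' := fun _ h => h.1

/-- The hypotheses under which `G(F, F')` is virtually simple: `F'` lies between `F` and the Young
group of its orbits, is transitive and is generated by its point stabilizers. -/
structure Setting (c : Coloring T X) (F F' : Subgroup (Equiv.Perm X)) : Prop where
  /-- The graph is a tree. -/
  tree : T.IsTree
  /-- The coloring is legal. -/
  legal : c.IsLegal
  /-- There are at least three colors (unless there is none). -/
  three : ∀ a b : X, ∃ e, e ≠ a ∧ e ≠ b
  /-- `F` is contained in `F'`. -/
  le : F ≤ F'
  /-- `F'` preserves the orbits of `F`. -/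
  young : F' ≤ orbitYoungGroup F
  /-- `F'` is transitive. -/
  trans : ∀ a b : X, ∃ σ ∈ F', σ a = b
  /-- `F'` is generated by its point stabilizers. -/
  gen : ∀ Q : Subgroup (Equiv.Perm X), (∀ σ ∈ F', ∀ x, σ x = x → σ ∈ Q) → F' ≤ Q

namespace Setting

theorem exists_ne_of_fix (S : Setting c F F') (b : X) : ∃ a, ∃ ρ ∈ F', ρ a = a ∧ ρ b ≠ b := by
  by_contra h
  push Not at h
  obtain ⟨e, he, -⟩ := S.three b b
  obtain ⟨σ, hσ, hσe⟩ := S.trans b e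
  have : F' ≤ MulAction.stabilizer (Equiv.Perm X) b :=
    S.gen _ fun σ hσ x hx => h x σ hσ hx
  exact he (hσe.symm.trans (this hσ))

/-- The stabilizer of a vertex in `ristCommutator` realizes all of `F'` as local actions. -/
theorem exists_ristCommutator_localAction (S : Setting c F F') (w : V) {σ : Equiv.Perm X}
    (hσ : σ ∈ F') :
    ∃ m ∈ ristCommutator c F F', m w = w ∧ localAction c m w = σ := by
  have hT := S.tree
  have hc := S.legal
  let Q : Subgroup (Equiv.Perm X) :=
    { carrier := {σ | ∃ m ∈ ristCommutator c F F', m w = w ∧ localAction c m w = σ}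
      one_mem' := ⟨1, one_mem _, rfl, localAction_one c w⟩
      mul_mem' := by
        rintro _ _ ⟨m, hm, hmw, rfl⟩ ⟨l, hl, hlw, rfl⟩
        exact ⟨m * l, mul_mem hm hl, by rw [RelIso.mul_apply, hlw, hmw],
          by rw [localAction_mul, hlw]⟩
      inv_mem' := by
        rintro _ ⟨m, hm, hmw, rfl⟩
        have h : m⁻¹ w = w := m.symm_apply_eq.2 hmw.symm
        exact ⟨m⁻¹, inv_mem hm, h, by rw [localAction_inv, h]⟩ }
  refine S.gen Q (fun τ hτ b hb => ?_) hσ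
  -- `k` fixes the neighbour `v` of `w` and moves `w`, so near `w` the commutator acts as `s`
  obtain ⟨s, hs, hsw, hsl⟩ := exists_rist_localAction_eq (c := c) hT hc S.le S.young hτ w hb
  obtain ⟨a, ρ, hρ, hρa, hρb⟩ := S.exists_ne_of_fix b
  obtain ⟨k, hk, hkv, hkl⟩ :=
    exists_rist_localAction_eq (c := c) hT hc S.le S.young hρ (c.nb w b) hρa
  have hab : b ≠ a := by
    rintro rfl
    exact hρb hρa
  have hs' : s ∈ rist c F F' (c.nb (c.nb w b) a) a := by
    refine rist_mono _ _ _ _ (fun u hu => ?_) hs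
    exact (mem_half_nb_iff hT hc).2
      (Set.disjoint_left.1 (half_disjoint_of_ne hT hc (c.nb w b) hab) hu)
  have hr := rist_conj hT hc hk.1 (inv_mem hs)
  rw [hkv, hkl] at hr
  have hw : w ∉ c.half (c.nb w b) (ρ b) := by
    have h1 := nb_mem_half c (c.nb w b) b
    rw [hc.nb_nb] at h1
    exact Set.disjoint_left.1 (half_disjoint_of_ne hT hc (c.nb w b) hρb.symm) h1
  have heq : ⁅s, k⁆ = s * (k * s⁻¹ * k⁻¹) := by
    rw [commutatorElement_def]
    group
  refine ⟨⁅s, k⁆, commutator_mem_ristCommutator hs' hk, ?_, ?_⟩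
  · rw [heq, RelIso.mul_apply, hr.2 w hw, hsw]
  · rw [heq, localAction_mul, hr.2 w hw, rist_localAction hT hc hr hw, mul_one, hsl]

theorem ristCommutator_locally_transitive (S : Setting c F F') (w : V) (a b : X) :
    ∃ m ∈ ristCommutator c F F', m w = w ∧ m (c.nb w a) = c.nb w b := by
  obtain ⟨σ, hσ, hab⟩ := S.trans a b
  obtain ⟨m, hm, hmw, hml⟩ := S.exists_ristCommutator_localAction w hσ
  exact ⟨m, hm, hmw, by rw [apply_nb, hmw, hml, hab]⟩

theorem exists_ristCommutator_dart (S : Setting c F F') {v u : V}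
    (h : ∃ m ∈ ristCommutator c F F', m v = u) (a b : X) :
    ∃ m ∈ ristCommutator c F F', m v = u ∧ localAction c m v a = b := by
  obtain ⟨m, hm, hmv⟩ := h
  obtain ⟨σ, hσ, hab⟩ := S.trans a ((localAction c m v)⁻¹ b)
  obtain ⟨l, hl, hlv, hll⟩ := S.exists_ristCommutator_localAction v hσ
  refine ⟨m * l, mul_mem hm hl, by rw [RelIso.mul_apply, hlv, hmv], ?_⟩
  rw [localAction_mul, hlv, hll, Equiv.Perm.mul_apply, hab, Equiv.Perm.coe_inv,
    Equiv.apply_symm_apply]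

/-- Any half-tree can be moved into any other one by `ristCommutator`. -/
theorem exists_half_subset (S : Setting c F F') (v' : V) (a' : X) (v : V) (a : X) :
    ∃ m ∈ ristCommutator c F F', c.half (m v') (localAction c m v' a') ⊆ c.half v a := by
  have inv : ∀ {x y : V}, (∃ m ∈ ristCommutator c F F', m x = y) →
      ∃ m ∈ ristCommutator c F F', m y = x := by
    rintro x y ⟨m, hm, rfl⟩
    exact ⟨m⁻¹, inv_mem hm, m.symm_apply_apply x⟩
  rcases exists_apply_eq_or S.tree S.legal S.ristCommutator_locally_transitive v a v' with h | h
  · obtain ⟨m, hm, h1, h2⟩ := S.exists_ristCommutator_dart (inv h) a' a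
    exact ⟨m, hm, by rw [h1, h2]⟩
  · obtain ⟨e, he, -⟩ := S.three a a
    obtain ⟨m, hm, h1, h2⟩ := S.exists_ristCommutator_dart (inv h) a' e
    exact ⟨m, hm, by rw [h1, h2]; exact half_nb_subset S.tree S.legal v he⟩

/-! ### The quotient by `ristCommutator` -/

theorem commutator_rist_mem (S : Setting c F F') {v v' : V} {a a' : X}
    {k l : T ≃g T} (hk : k ∈ rist c F F' v a) (hl : l ∈ rist c F F' v' a') :
    ⁅k, l⁆ ∈ ristCommutator c F F' := by
  obtain ⟨b, hb, -⟩ := S.three a a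
  obtain ⟨m, hm, hsub⟩ := S.exists_half_subset v' a' v b
  have hl' := rist_conj S.tree S.legal (ristCommutator_le hm) hl
  have hcomm := rist_commute
    ((half_disjoint_of_ne S.tree S.legal v hb.symm).mono_right hsub) hk hl'
  -- `l` agrees modulo `ristCommutator` with a conjugate that commutes with `k`
  have hn : m * l * m⁻¹ * l⁻¹ ∈ ristCommutator c F F' := by
    have := mul_mem hm (ristCommutator_conj S.tree S.legal hl.1 (inv_mem hm))
    simpa only [mul_assoc] using this
  have heq : ⁅k, l⁆ = k * (m * l * m⁻¹ * l⁻¹)⁻¹ * k⁻¹ * (m * l * m⁻¹ * l⁻¹) := by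
    have h2 : k * (m * l * m⁻¹) * k⁻¹ * (m * l * m⁻¹)⁻¹ = 1 := by
      rw [hcomm]
      group
    calc ⁅k, l⁆ = (k * (m * l * m⁻¹ * l⁻¹)⁻¹ * k⁻¹) *
          (k * (m * l * m⁻¹) * k⁻¹ * (m * l * m⁻¹)⁻¹) * (m * l * m⁻¹ * l⁻¹) := by
            rw [commutatorElement_def]
            group
      _ = _ := by rw [h2, mul_one]
  rw [heq]
  exact mul_mem (ristCommutator_conj S.tree S.legal hk.1 (inv_mem hn)) hn

/-- The quotient of `ristGroup` by `ristCommutator` is abelian. -/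
theorem commutator_ristGroup_mem (S : Setting c F F') {p q : T ≃g T} (hp : p ∈ ristGroup c F F')
    (hq : q ∈ ristGroup c F F') : ⁅p, q⁆ ∈ ristCommutator c F F' := by
  -- the elements that commute with `q` modulo `ristCommutator`
  let C : (T ≃g T) → Subgroup (T ≃g T) := fun q =>
    { carrier := {p | p ∈ restrictedBurgerMozes c F F' ∧ ⁅p, q⁆ ∈ ristCommutator c F F'}
      one_mem' := ⟨one_mem _, by rw [commutatorElement_one_left]; exact one_mem _⟩
      mul_mem' := by
        rintro x y ⟨hx, hxq⟩ ⟨hy, hyq⟩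
        refine ⟨mul_mem hx hy, ?_⟩
        have : ⁅x * y, q⁆ = x * ⁅y, q⁆ * x⁻¹ * ⁅x, q⁆ := by
          simp only [commutatorElement_def]
          group
        rw [this]
        exact mul_mem (ristCommutator_conj S.tree S.legal hx hyq) hxq
      inv_mem' := by
        rintro x ⟨hx, hxq⟩
        refine ⟨inv_mem hx, ?_⟩
        have : ⁅x⁻¹, q⁆ = x⁻¹ * ⁅x, q⁆⁻¹ * x⁻¹⁻¹ := by
          simp only [commutatorElement_def]
          group
        rw [this]
        exact ristCommutator_conj S.tree S.legal (inv_mem hx) (inv_mem hxq) }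
  have h1 : ∀ v a, ∀ l ∈ rist c F F' v a, ∀ p ∈ ristGroup c F F',
      ⁅p, l⁆ ∈ ristCommutator c F F' := by
    intro v a l hl p hp
    have : ristGroup c F F' ≤ C l :=
      ristGroup_le_iff.2 fun v' a' k hk => ⟨hk.1, S.commutator_rist_mem hk hl⟩
    exact (this hp).2
  have h2 : ristGroup c F F' ≤ C p := by
    refine ristGroup_le_iff.2 fun v a l hl => ⟨hl.1, ?_⟩
    rw [← commutatorElement_inv]
    exact inv_mem (h1 v a l hl p hp)
  rw [← commutatorElement_inv]
  exact inv_mem (h2 hq).2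

theorem mem_ristGroup_of_fix [Finite X] (S : Setting c F F') {g : T ≃g T}
    (hg : g ∈ restrictedBurgerMozes c F F')
    {v : V} (hv : g v = v) : g ∈ ristGroup c F F' := by
  obtain ⟨m, hm, hmv, hml⟩ := S.exists_ristCommutator_localAction v (hg.1 v)
  have hinv : m⁻¹ v = v := m.symm_apply_eq.2 hmv.symm
  have : m⁻¹ * g ∈ ristGroup c F F' := by
    refine mem_of_forall_restrict_mem S.tree S.legal _
      (mul_mem (inv_mem (ristCommutator_le hm)) hg) (v := v) ?_ ?_
      fun a k hk _ => rist_le_ristGroup v a hk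
    · rw [RelIso.mul_apply, hv, hinv]
    · rw [localAction_mul, hv, localAction_inv, hinv, hml, inv_mul_cancel]
  have := mul_mem (ristCommutator_le_ristGroup hm) this
  rwa [mul_inv_cancel_left] at this

theorem mem_ristGroup_of_apply_eq [Finite X] (S : Setting c F F') {g m : T ≃g T}
    (hg : g ∈ restrictedBurgerMozes c F F') (hm : m ∈ ristCommutator c F F') {v : V}
    (h : m v = g v) : g ∈ ristGroup c F F' := by
  have : m⁻¹ * g ∈ ristGroup c F F' := by
    refine S.mem_ristGroup_of_fix (mul_mem (inv_mem (ristCommutator_le hm)) hg) (v := v) ?_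
    rw [RelIso.mul_apply, ← h]
    exact m.symm_apply_apply v
  have := mul_mem (ristCommutator_le_ristGroup hm) this
  rwa [mul_inv_cancel_left] at this

theorem mem_ristCommutator_of_localAction_mem [Finite X] (S : Setting c F F') {v : V}
    {a : X} {k : T ≃g T}
    (hk : k ∈ rist c F F' v a) (hkF : ∀ u, localAction c k u ∈ F) :
    k ∈ ristCommutator c F F' := by
  obtain ⟨b, hb, -⟩ := S.three a a
  obtain ⟨e, hea, heb⟩ := S.three a b
  obtain ⟨t, ht, htv, hd⟩ := exists_translation S.tree S.legal v hb.symm hea.symm heb.symm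
  obtain ⟨x, hx, hxt, hxv⟩ := exists_commutator_eq S.tree S.legal S.le ht hd hk hkF
  rw [← hxt]
  refine S.commutator_ristGroup_mem (S.mem_ristGroup_of_fix hx hxv) ?_
  obtain ⟨m, hm, -, hmv⟩ := S.ristCommutator_locally_transitive (c.nb v b) b e
  rw [S.legal.nb_nb] at hmv
  exact S.mem_ristGroup_of_apply_eq (colorGroup_le c F F' ht) hm (hmv.trans htv.symm)

/-- An element of `single v` is determined modulo `ristCommutator` by its local action at `v`. -/
theorem inv_mul_mem_of_localAction_eq [Finite X] (S : Setting c F F') {v : V} {s s' : T ≃g T}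
    (hs : s ∈ single c F F' v) (hs' : s' ∈ single c F F' v)
    (h : localAction c s v = localAction c s' v) : s⁻¹ * s' ∈ ristCommutator c F F' := by
  have hr := mul_mem (inv_mem hs) hs'
  have hone : localAction c (s⁻¹ * s') v = 1 := by
    rw [localAction_mul, hs'.2.1, localAction_inv, (inv_mem hs).2.1, h, inv_mul_cancel]
  refine mem_of_forall_restrict_mem S.tree S.legal _ hr.1 hr.2.1 hone fun a k hk hku => ?_
  refine S.mem_ristCommutator_of_localAction_mem hk fun u => ?_
  by_cases hu : u ∈ c.half v a
  · rw [hku u hu]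
    exact hr.2.2 u fun h' => notMem_half c S.tree v a (h' ▸ hu)
  · rw [rist_localAction S.tree S.legal hk hu]
    exact one_mem _

/-- Multiplication with finitely many elements having one exceptional vertex each brings all local
actions of an element of `G(F, F')` into `F`. -/
theorem exists_mul_localAction_mem (S : Setting c F F') {g : T ≃g T}
    (hg : g ∈ restrictedBurgerMozes c F F') :
    ∃ r ∈ ⨆ w, single c F F' w, ∀ u, localAction c (g * r) u ∈ F := by
  induction hn : {v | localAction c g v ∉ F}.ncard using Nat.strong_induction_on generalizing g with
  | _ n ih =>
    by_cases h : ∀ u, localAction c g u ∈ F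
    · exact ⟨1, one_mem _, by simpa using h⟩
    · push Not at h
      obtain ⟨w, hw⟩ := h
      obtain ⟨s, hs, hsw, hsl, hsF⟩ :=
        exists_localAction_eq (c := c) S.tree S.legal S.le S.young (inv_mem (hg.1 w)) w
      have hss : s ∈ single c F F' w := ⟨hs, hsw, hsF⟩
      have hgs := mul_mem hg hs
      have hlt : {v | localAction c (g * s) v ∉ F}.ncard < n := by
        rw [← hn]
        have hle : {v | localAction c (g * s) v ∉ F}.ncard ≤
            ({v | localAction c g v ∉ F} \ {w}).ncard := by
          refine Set.ncard_le_ncard_of_injOn s (fun u hu => ?_) s.injective.injOn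
            (hg.2.subset Set.sdiff_subset)
          rw [Set.mem_ofPred_eq, localAction_mul] at hu
          have huw : u ≠ w := by
            rintro rfl
            rw [hsw, hsl, mul_inv_cancel] at hu
            exact hu (one_mem _)
          refine ⟨fun h' => hu (mul_mem h' (hsF u huw)), fun h' => huw ?_⟩
          rw [Set.mem_singleton_iff] at h'
          rw [← hsw] at h'
          exact s.injective h'
        exact hle.trans_lt (Set.ncard_sdiff_singleton_lt_of_mem hw hg.2)
      obtain ⟨r, hr, hrF⟩ := ih _ hlt hgs rfl
      refine ⟨s * r, mul_mem (Subgroup.mem_iSup_of_mem w hss) hr, fun u => ?_⟩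
      rw [← mul_assoc]
      exact hrF u

/-- The elements with all local actions in `F` lie in the union of two double cosets of the group
generated by the elements with at most one exceptional vertex. -/
theorem mem_or_exists_mul_mul (S : Setting c F F') {v : V} {a : X} {t : T ≃g T}
    (ht : t ∈ colorGroup c)
    (htv : t v = c.nb v a) {g : T ≃g T} (hg : ∀ u, localAction c g u ∈ F) :
    g ∈ ⨆ w, single c F F' w ∨ ∃ r ∈ ⨆ w, single c F F' w, ∃ s ∈ ⨆ w, single c F F' w,
      g = r * t * s := by
  -- only elements with all local actions in `F` are used to move `v`, so that the quotients below
  -- still have all local actions in `F`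
  let W : Subgroup (T ≃g T) := (⨆ w, single c F F' w) ⊓ restrictedBurgerMozes c F F
  have hsingle : ∀ {x : T ≃g T} {w : V}, (∀ u, localAction c x u ∈ F) → x w = w →
      x ∈ ⨆ w, single c F F' w := fun hx hw => Subgroup.mem_iSup_of_mem _
    ⟨mem_restrictedBurgerMozes_of_forall S.le hx, hw, fun u _ => hx u⟩
  have hW : ∀ w a b, ∃ h ∈ W, h w = w ∧ h (c.nb w a) = c.nb w b := by
    intro w a b
    obtain ⟨σ, hσ, hσab⟩ := S.trans a b
    obtain ⟨f, hf, hfa⟩ := exists_mem_apply_eq (S.young hσ) a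
    obtain ⟨x, hxw, hx⟩ := exists_automorphism S.tree S.legal (fun _ => f) (fun _ _ => rfl) w w
    have hxF : ∀ u, localAction c x u ∈ F := fun u => by rw [hx]; exact hf
    refine ⟨x, ⟨hsingle hxF hxw, mem_restrictedBurgerMozes_of_forall le_rfl hxF⟩, hxw, ?_⟩
    rw [apply_nb, hxw, hx, hfa, hσab]
  have hgF : g ∈ restrictedBurgerMozes c F F := mem_restrictedBurgerMozes_of_forall le_rfl hg
  rcases exists_apply_eq_or S.tree S.legal hW v a (g v) with ⟨r, hr, hrv⟩ | ⟨r, hr, hrv⟩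
  · left
    have : r⁻¹ * g ∈ ⨆ w, single c F F' w := by
      have hrg : r⁻¹ * g ∈ restrictedBurgerMozes c F F := mul_mem (inv_mem hr.2) hgF
      refine hsingle (w := v) hrg.1 ?_
      rw [RelIso.mul_apply, ← hrv]
      exact r.symm_apply_apply v
    have := mul_mem hr.1 this
    rwa [mul_inv_cancel_left] at this
  · right
    refine ⟨r, hr.1, t⁻¹ * (r⁻¹ * g), ?_, by group⟩
    have htrg : t⁻¹ * (r⁻¹ * g) ∈ restrictedBurgerMozes c F F :=
      mul_mem (inv_mem (colorGroup_le c F F ht)) (mul_mem (inv_mem hr.2) hgF)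
    refine hsingle (w := v) htrg.1 ?_
    rw [RelIso.mul_apply, RelIso.mul_apply, ← hrv, ← htv]
    exact (congrArg _ (r.symm_apply_apply (t v))).trans (t.symm_apply_apply v)

/-- `ristCommutator` has finite index: modulo it, the elements with one exceptional vertex at `w`
form a finite group, which depends only on the orbit of `w`, and the groups for the two orbits
commute. -/
theorem finiteIndex [Finite X] [Nonempty X] (S : Setting c F F') :
    ((ristCommutator c F F').subgroupOf (restrictedBurgerMozes c F F')).FiniteIndex := by
  have hT := S.tree
  have hc := S.legal
  let G := restrictedBurgerMozes c F F'
  have hnormal : ((ristCommutator c F F').subgroupOf G).Normal :=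
    normal_subgroupOf fun g hg k hk => ristCommutator_conj hT hc hg hk
  let π : G →* G ⧸ (ristCommutator c F F').subgroupOf G := QuotientGroup.mk' _
  have hπ : ∀ x y : G, x.1⁻¹ * y.1 ∈ ristCommutator c F F' → π x = π y := fun x y h =>
    QuotientGroup.eq.2 h
  let B : V → Subgroup (G ⧸ (ristCommutator c F F').subgroupOf G) := fun w =>
    ((single c F F' w).subgroupOf G).map π
  have hB : ∀ w, Finite (B w) := by
    intro w
    let rep : B w → G := fun b => b.2.choose
    have hrep : ∀ b, (rep b).1 ∈ single c F F' w ∧ π (rep b) = b := fun b => b.2.choose_spec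
    refine Finite.of_injective (fun b => localAction c (rep b).1 w) fun b b' h => ?_
    refine Subtype.ext ?_
    rw [← (hrep b).2, ← (hrep b').2]
    exact hπ _ _ (S.inv_mul_mem_of_localAction_eq (hrep b).1 (hrep b').1 h)
  obtain ⟨v⟩ := hT.connected.nonempty
  obtain ⟨a⟩ := ‹Nonempty X›
  obtain ⟨t, ht, htv⟩ := exists_mem_colorGroup (c := c) hT hc v (c.nb v a)
  have hcomm : ∀ x y : G, x.1 ∈ ristGroup c F F' → y.1 ∈ ristGroup c F F' →
      π x * π y = π y * π x := by
    intro x y hx hy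
    rw [← map_mul, ← map_mul]
    refine (hπ _ _ ?_).symm
    have : (y * x : G).1⁻¹ * (x * y : G).1 = ⁅x.1⁻¹, y.1⁻¹⁆ := by
      simp only [Subgroup.coe_mul, commutatorElement_def]
      group
    rw [this]
    exact S.commutator_ristGroup_mem (inv_mem hx) (inv_mem hy)
  have hsingle : ∀ {x : T ≃g T} {w : V}, x ∈ single c F F' w → x ∈ ristGroup c F F' :=
    fun hx => S.mem_ristGroup_of_fix hx.1 hx.2.1
  -- color-preserving automorphisms in `ristGroup` conjugate `single u` to `single w`
  have horbit : ∀ u w, (∃ m ∈ ristCommutator c F F', m u = w) → B w ≤ B u := by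
    rintro u w ⟨m, hm, hmu⟩ _ ⟨x, hx, rfl⟩
    have hx : x.1 ∈ single c F F' w := hx
    obtain ⟨h, hh, hhu⟩ := exists_mem_colorGroup (c := c) hT hc u w
    have hhG : h ∈ G := colorGroup_le c F F' hh
    have hhP := S.mem_ristGroup_of_apply_eq hhG hm (hmu.trans hhu.symm)
    let y : G := ⟨h⁻¹, inv_mem hhG⟩ * x * ⟨h⁻¹, inv_mem hhG⟩⁻¹
    refine ⟨y, ⟨y.2, ?_, fun z hz => ?_⟩, ?_⟩
    · change h⁻¹ (x.1 (h u)) = u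
      rw [hhu, hx.2.1, ← hhu]
      exact h.symm_apply_apply u
    · have : localAction c y.1 z = localAction c x.1 (h z) :=
        localAction_conj (inv_mem hh) x.1 z
      change localAction c y.1 z ∈ F
      rw [this]
      refine hx.2.2 _ fun h' => hz (h.injective (h'.trans hhu.symm))
    · simp only [y, map_mul, map_inv]
      rw [hcomm _ x (inv_mem hhP) (hsingle hx), mul_inv_cancel_right]
  have hBR : ∀ w, B w ≤ B v ⊔ B (c.nb v a) := by
    intro w
    rcases exists_apply_eq_or hT hc S.ristCommutator_locally_transitive v a w with h | h
    · exact (horbit _ _ h).trans le_sup_left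
    · exact (horbit _ _ h).trans le_sup_right
  have hRfin : Finite (B v ⊔ B (c.nb v a) : Subgroup _) := by
    have comm : ∀ (m : B v) (n : B (c.nb v a)), Commute ((B v).subtype m)
        ((B (c.nb v a)).subtype n) := by
      rintro ⟨_, x, hx, rfl⟩ ⟨_, y, hy, rfl⟩
      exact hcomm x y (hsingle hx) (hsingle hy)
    have hr := MonoidHom.noncommCoprod_range (B v).subtype (B (c.nb v a)).subtype comm
    rw [Subgroup.range_subtype, Subgroup.range_subtype] at hr
    rw [← hr]
    have := hB v
    have := hB (c.nb v a)
    exact Finite.of_surjective _ (MonoidHom.rangeRestrict_surjective _)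
  have hWR : ∀ x : G, x.1 ∈ ⨆ w, single c F F' w → π x ∈ B v ⊔ B (c.nb v a) := by
    have : ⨆ w, single c F F' w ≤ ((B v ⊔ B (c.nb v a)).comap π).map G.subtype :=
      iSup_le fun w x hx => ⟨⟨x, hx.1⟩, hBR w ⟨⟨x, hx.1⟩, hx, rfl⟩, rfl⟩
    intro x hx
    obtain ⟨y, hy, hyx⟩ := this hx
    rwa [← Subtype.ext (hyx : y.1 = x.1)]
  have hWG : ⨆ w, single c F F' w ≤ G := iSup_le fun w => single_le w
  let R : Set (G ⧸ (ristCommutator c F F').subgroupOf G) := (B v ⊔ B (c.nb v a) : Subgroup _)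
  have hcover : (Set.univ : Set (G ⧸ (ristCommutator c F F').subgroupOf G)) ⊆
      R ∪ Set.image2 (fun x y => x * π ⟨t, colorGroup_le c F F' ht⟩ * y) R R := by
    rintro q -
    obtain ⟨g, rfl⟩ := QuotientGroup.mk'_surjective _ q
    obtain ⟨r, hr, hgr⟩ := S.exists_mul_localAction_mem g.2
    rcases S.mem_or_exists_mul_mul ht htv hgr with h | ⟨r', hr', s, hs, h⟩
    · left
      refine hWR g ?_
      have := mul_mem h (inv_mem hr)
      rwa [mul_inv_cancel_right] at this
    · right
      have hsr := mul_mem hs (inv_mem hr)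
      refine ⟨_, hWR ⟨r', hWG hr'⟩ hr', _, hWR ⟨s * r⁻¹, hWG hsr⟩ hsr, ?_⟩
      simp only [← map_mul]
      refine congrArg π (Subtype.ext ?_)
      change r' * t * (s * r⁻¹) = g.1
      rw [← mul_assoc, ← h, mul_inv_cancel_right]
  have hRfin' : R.Finite := Set.toFinite R
  have : Finite (G ⧸ (ristCommutator c F F').subgroupOf G) :=
    Set.finite_univ_iff.1 ((hRfin'.union (hRfin'.image2 _ hRfin')).subset hcover)
  exact Subgroup.finiteIndex_of_finite_quotient

/-! ### Simplicity -/

/-- A nontrivial automorphism maps some half-tree to a disjoint one. -/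
theorem exists_half_disjoint (S : Setting c F F') {n : T ≃g T} (hn : n ≠ 1) :
    ∃ u a, Disjoint (c.half u a) (c.half (n u) (localAction c n u a)) := by
  obtain ⟨u, hu⟩ : ∃ u, n u ≠ u := by
    by_contra h
    push Not at h
    exact hn (RelIso.ext h)
  obtain ⟨p, hp⟩ := exists_mem_half S.tree S.legal hu
  obtain ⟨q, hq⟩ := exists_mem_half S.tree S.legal hu.symm
  -- avoid the directions from `u` towards `n u` and from `n u` towards `u`
  obtain ⟨a, hap, haq⟩ := S.three p ((localAction c n u)⁻¹ q)
  have haq' : localAction c n u a ≠ q := fun h => haq (by rw [← h]; simp)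
  exact ⟨u, a, half_disjoint S.tree S.legal hu.symm
    (Set.disjoint_left.1 (half_disjoint_of_ne S.tree S.legal u hap.symm) hp)
    (Set.disjoint_left.1 (half_disjoint_of_ne S.tree S.legal (n u) haq'.symm) hq)⟩

/-- The double commutator argument: a nontrivial subgroup normalized by `ristCommutator` contains
the commutator subgroup of every rigid stabilizer. The elements `k` and `l` need not lie in
`ristCommutator`, so they are first corrected by conjugates of their inverses under
`ristCommutator`, with supports disjoint from each other. -/
theorem commutator_mem_of_normalized (S : Setting c F F') {N : Subgroup (T ≃g T)}
    (hNM : N ≤ ristCommutator c F F')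
    (hN : ∀ m ∈ ristCommutator c F F', ∀ n ∈ N, m * n * m⁻¹ ∈ N) (hbot : N ≠ ⊥)
    {v : V} {a : X} {k l : T ≃g T} (hk : k ∈ rist c F F' v a) (hl : l ∈ rist c F F' v a) :
    ⁅k, l⁆ ∈ N := by
  have hT := S.tree
  have hc := S.legal
  obtain ⟨n, hn, hn1⟩ := N.bot_or_exists_ne_one.resolve_left hbot
  obtain ⟨u, b, hd⟩ := S.exists_half_disjoint hn1
  -- three pairwise disjoint images of the half-tree `half v a` inside `half u b`
  obtain ⟨e, heb, -⟩ := S.three b b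
  obtain ⟨f, hfb, hfe⟩ := S.three b e
  obtain ⟨m₀, hm₀, h₀⟩ := S.exists_half_subset v a (c.nb (c.nb u b) e) f
  obtain ⟨m₁, hm₁, h₁⟩ := S.exists_half_subset v a (c.nb u b) f
  obtain ⟨m₂, hm₂, h₂⟩ := S.exists_half_subset v a (c.nb (c.nb u b) e) b
  have d02 := (half_disjoint_of_ne hT hc (c.nb (c.nb u b) e) hfb).mono h₀ h₂
  have s0 := h₀.trans (half_nb_subset hT hc (c.nb u b) hfe)
  have s2 := h₂.trans (half_nb_subset hT hc (c.nb u b) heb.symm)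
  have d01 := (half_disjoint_of_ne hT hc (c.nb u b) hfe.symm).mono s0 h₁
  have d12 := (half_disjoint_of_ne hT hc (c.nb u b) hfe).mono h₁ s2
  have conj : ∀ {m x : T ≃g T}, m ∈ ristCommutator c F F' → x ∈ rist c F F' v a →
      m * x * m⁻¹ ∈ rist c F F' (m v) (localAction c m v a) := fun hm hx =>
    rist_conj hT hc (ristCommutator_le hm) hx
  have mono : ∀ {w : V} {x : X}, c.half w x ⊆ c.half u b → rist c F F' w x ≤ rist c F F' u b :=
    fun h => rist_mono _ _ _ _ h
  have s0' := s0.trans (half_nb_subset hT hc u heb)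
  have s1' := h₁.trans (half_nb_subset hT hc u hfb)
  have s2' := s2.trans (half_nb_subset hT hc u heb)
  -- a difference of two conjugates lies in `ristCommutator`
  have diff : ∀ {m m' x : T ≃g T}, m ∈ ristCommutator c F F' → m' ∈ ristCommutator c F F' →
      x ∈ rist c F F' v a → m * x * m⁻¹ * (m' * x⁻¹ * m'⁻¹) ∈ ristCommutator c F F' := by
    intro m m' x hm hm' hx
    have h := mul_mem (mul_mem hm (ristCommutator_conj hT hc hx.1 (mul_mem (inv_mem hm) hm')))
      (inv_mem hm')
    have : m * x * m⁻¹ * (m' * x⁻¹ * m'⁻¹) = m * (x * (m⁻¹ * m') * x⁻¹) * m'⁻¹ := by group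
    rwa [this]
  set k₀ := m₀ * k * m₀⁻¹ with hk₀
  set l₀ := m₀ * l * m₀⁻¹ with hl₀
  set k₁ := m₁ * k⁻¹ * m₁⁻¹ with hk₁
  set l₂ := m₂ * l⁻¹ * m₂⁻¹ with hl₂
  have rk₀ := conj hm₀ hk
  have rl₀ := conj hm₀ hl
  have rk₁ := conj hm₁ (inv_mem hk)
  have rl₂ := conj hm₂ (inv_mem hl)
  have hp : k₀ * k₁ ∈ ristCommutator c F F' := diff hm₀ hm₁ hk
  have hq : l₀ * l₂ ∈ ristCommutator c F F' := diff hm₀ hm₂ hl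
  have rp : k₀ * k₁ ∈ rist c F F' u b := mul_mem (mono s0' rk₀) (mono s1' rk₁)
  have rq : l₀ * l₂ ∈ rist c F F' u b := mul_mem (mono s0' rl₀) (mono s2' rl₂)
  have hpq : ⁅k₀ * k₁, l₀ * l₂⁆ = ⁅k₀, l₀⁆ := by
    have c1 : Commute k₁ (l₀ * l₂) :=
      (show Commute k₁ l₀ from rist_commute d01.symm rk₁ rl₀).mul_right
        (rist_commute d12 rk₁ rl₂)
    have c2 : Commute k₀ l₂ := rist_commute d02 rk₀ rl₂
    calc ⁅k₀ * k₁, l₀ * l₂⁆ = k₀ * (k₁ * (l₀ * l₂)) * k₁⁻¹ * k₀⁻¹ * (l₀ * l₂)⁻¹ := by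
          rw [commutatorElement_def]
          group
      _ = k₀ * l₀ * (l₂ * k₀⁻¹) * l₂⁻¹ * l₀⁻¹ := by
          rw [c1.eq]
          group
      _ = ⁅k₀, l₀⁆ := by
          rw [← c2.inv_left.eq, commutatorElement_def]
          group
  -- `z` acts on `half u b` as `k₀ * k₁`
  set p := k₀ * k₁ with hpdef
  set q := l₀ * l₂ with hqdef
  have hz : n * p⁻¹ * n⁻¹ * p ∈ N := by
    have := mul_mem hn (hN _ (inv_mem hp) _ (inv_mem hn))
    rw [inv_inv] at this
    simpa only [mul_assoc] using this
  have ry := rist_conj hT hc (ristCommutator_le (hNM hn)) (inv_mem rp)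
  have cq : Commute (n * p⁻¹ * n⁻¹) q := rist_commute hd.symm ry rq
  have cp : Commute (n * p⁻¹ * n⁻¹) p := rist_commute hd.symm ry rp
  have hzq : ⁅n * p⁻¹ * n⁻¹ * p, q⁆ = ⁅p, q⁆ := by
    have h1 : Commute (n * p⁻¹ * n⁻¹) ⁅p, q⁆ := by
      rw [commutatorElement_def]
      exact ((cp.mul_right cq).mul_right cp.inv_right).mul_right cq.inv_right
    rw [commutatorElement_mul_left_eq_conj_mul, h1.eq, mul_inv_cancel_right, cq.commutator_eq,
      mul_one]
  have hmem : ⁅p, q⁆ ∈ N := by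
    rw [← hzq, commutatorElement_def, mul_assoc, mul_assoc]
    refine mul_mem hz ?_
    rw [← mul_assoc]
    exact hN _ hq _ (inv_mem hz)
  rw [hpq] at hmem
  have := hN _ (inv_mem hm₀) _ hmem
  rw [conjugate_commutatorElement] at this
  have e1 : m₀⁻¹ * k₀ * m₀⁻¹⁻¹ = k := by
    rw [hk₀]
    group
  have e2 : m₀⁻¹ * l₀ * m₀⁻¹⁻¹ = l := by
    rw [hl₀]
    group
  rwa [e1, e2] at this

theorem isSimpleGroup [Nonempty X] (S : Setting c F F') :
    IsSimpleGroup (ristCommutator c F F') := by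
  refine Subgroup.isSimpleGroup_iff.2 ⟨fun h => ?_, fun N hNM hN => ?_⟩
  · obtain ⟨a⟩ := ‹Nonempty X›
    obtain ⟨v⟩ := S.tree.connected.nonempty
    obtain ⟨b, hb, -⟩ := S.three a a
    obtain ⟨m, hm, -, hmv⟩ := S.ristCommutator_locally_transitive v a b
    rw [h, Subgroup.mem_bot] at hm
    subst hm
    exact hb (nb_injective c v hmv).symm
  · refine or_iff_not_imp_left.2 fun hbot => le_antisymm hNM ?_
    refine ristCommutator_le_iff.2 fun v a k hk l hl => ?_
    exact S.commutator_mem_of_normalized hNM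
      (fun m hm n hn => hN.conj_mem ⟨n, hNM hn⟩ hn ⟨m, hm⟩) hbot hk hl

theorem virtuallySimple [Finite X] [Nonempty X] (S : Setting c F F') :
    VirtuallySimple (restrictedBurgerMozes c F F') := by
  refine ⟨_, S.finiteIndex, ?_⟩
  have := S.isSimpleGroup
  exact (Subgroup.subgroupOfEquivOfLe ristCommutator_le).isSimpleGroup

end Setting

end Sufficiency

end BurgerMozes

theorem mainTheorem11 {V : Type*} (T : SimpleGraph V) [T.LocallyFinite] (d : ℕ) (hd : 2 < d)
    (hT : T.IsTree) (hreg : T.IsRegularOfDegree d)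
    (c : BurgerMozes.Coloring T (Fin d)) (hc : c.IsLegal)
    (F F' : Subgroup (Equiv.Perm (Fin d))) (hF' : ¬ BurgerMozes.ActsFreely F')
    (hFF' : F ≤ F') (hF'F : F' ≤ BurgerMozes.orbitYoungGroup F) :
    BurgerMozes.VirtuallySimple (BurgerMozes.restrictedBurgerMozes c F F') ↔
      MulAction.IsPretransitive F' (Fin d) ∧ BurgerMozes.GeneratedByPointStabilizers F' := by
  have hX : ∀ a b : Fin d, ∃ e, e ≠ a ∧ e ≠ b := by
    intro a b
    by_contra! h
    have hsub : (Finset.univ : Finset (Fin d)) ⊆ {a, b} := fun e _ => by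
      by_cases hea : e = a
      · simp [hea]
      · simp [h e hea]
    have := (Finset.card_le_card hsub).trans Finset.card_le_two
    rw [Finset.card_univ, Fintype.card_fin] at this
    omega
  refine ⟨BurgerMozes.transitive_and_generated_of_virtuallySimple hT hc hX hFF' hF'F hF',
    fun ⟨htrans, hgen⟩ => ?_⟩
  have : Nonempty (Fin d) := ⟨⟨0, by omega⟩⟩
  refine BurgerMozes.Setting.virtuallySimple ⟨hT, hc, hX, hFF', hF'F, fun a b => ?_, ?_⟩
  · obtain ⟨σ, hσ⟩ := htrans.exists_smul_eq a b
    exact ⟨σ.1, σ.2, hσ⟩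
  · intro Q hQ σ hσ
    have h : (⨆ x : Fin d, MulAction.stabilizer F' x) ≤ Q.comap F'.subtype :=
      iSup_le fun x ρ hρ => hQ ρ.1 ρ.2 x hρ
    rw [show (⨆ x : Fin d, MulAction.stabilizer F' x) = ⊤ from hgen] at h
    exact h (Subgroup.mem_top (⟨σ, hσ⟩ : F'))
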